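/- Let $\mathfrak g$ be a finite-dimensional complex semisimple Lie algebra, $\mathfrak h\subset\mathfrak g$ a Cartan subalgebra, $\Delta$ a base of the root system of $(\mathfrak g,\mathfrak h)$, $\mathfrak n=\bigoplus_{\alpha>0}\mathfrak g_\alpha$, $\mathfrak b=\mathfrak h\oplus\mathfrak n$ the corresponding Borel subalgebra, and $\mathfrak p\supseteq\mathfrak b$ a parabolic subalgebra. Let $\mathcal O$ be the BGG category of $\mathfrak g$-modules that are finitely generated, $\mathfrak h$-semisimple and locally $\mathfrak n$-finite. For $\mu\in\mathfrak h^*$ let $L(\mu)$ be the unique simple quotient of the Verma module $M(\mu)=U(\mathfrak g)\otimes_{U(\mathfrak b)}\mathbb C_\mu$. Let $M\in\mathcal O$. (1) Every direct summand $A$ of $\operatorname{Res}^{\mathfrak g}_{\mathfrak p}M$ admits a finite filtration by $\mathfrak p$-submodules $$0=A_0\subset A_1\subset\cdots\subset A_n=A$$ (with strict inclusions) such that, for each $0\le i<n$, $A_{i+1}/A_i\cong\operatorname{Res}^{\mathfrak g}_{\mathfrak p}L(\lambda_i)$ as $\mathfrak p$-modules for some $\lambda_i\in\mathfrak h^*$.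 (2) More precisely, if $\operatorname{Res}^{\mathfrak g}_{\mathfrak p}M=\bigoplus_{j=1}^mA^{(j)}$ with $\mathfrak p$-submodules $A^{(j)}$, then there exist a composition series $0=M_0\subset M_1\subset\cdots\subset M_l=M$ of the $\mathfrak g$-module $M$ and filtrations $0=A^{(j)}_0\subset\cdots\subset A^{(j)}_{n_j}=A^{(j)}$ as in (1), for $1\le j\le m$, such that for each $0\le i<l$ there exist indices $a_j\in\{0,\dots,n_j\}$ ($1\le j\le m$), an index $k\in\{1,\dots,m\}$ with $a_k<n_k$, and $\mu\in\mathfrak h^*$ with $$\operatorname{Res}^{\mathfrak g}_{\mathfrak p}M_i=A^{(1)}_{a_1}\oplus\cdots\oplus A^{(m)}_{a_m},\qquad \operatorname{Res}^{\mathfrak g}_{\mathfrak p}M_{i+1}=A^{(1)}_{a_1}\oplus\cdots\oplus A^{(k)}_{a_k+1}\oplus\cdots\oplus A^{(m)}_{a_m},$$ $M_{i+1}/M_i\cong L(\mu)$ as $\mathfrak g$-modules and $A^{(k)}_{a_k+1}/A^{(k)}_{a_k}\cong\operatorname{Res}^{\mathfrak g}_{\mathfrak p}L(\mu)$ as $\mathfrak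 p$-modules. -/

import Mathlib

open Module

noncomputable section

namespace CatO

section Setup

attribute [local instance] LieRing.ofAssociativeRing LieAlgebra.ofAssociativeAlgebra

variable {g : Type*} [LieRing g] [LieAlgebra ℂ g] [FiniteDimensional ℂ g] [LieAlgebra.IsSemisimple ℂ g]
  {H : LieSubalgebra ℂ g} [H.IsCartanSubalgebra]

/-- The nilradical `𝔫 = ⨁_{α > 0} 𝔤_α` of the Borel subalgebra attached to a base of the root
system of `(𝔤, 𝔥)`. -/
def nilradical (b : (LieAlgebra.IsKilling.rootSystem H).Base) : LieSubalgebra ℂ g where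
  __ := ⨆ (α : H.root) (_ : b.IsPos α), (LieAlgebra.rootSpace H (α : LieModule.Weight ℂ H g)).toSubmodule
  lie_mem' := by
    intro x y hx hy
    simp only [AddSubsemigroup.mem_carrier, AddSubmonoid.mem_toSubsemigroup,
      Submodule.mem_toAddSubmonoid] at hx hy ⊢
    induction hx using Submodule.iSup_induction' with
    | zero => simp
    | add x₁ x₂ _ _ h₁ h₂ => rw [add_lie]; exact Submodule.add_mem _ h₁ h₂
    | mem α x hx =>
    induction hx using Submodule.iSup_induction' with
    | zero => simp
    | add x₁ x₂ _ _ h₁ h₂ => rw [add_lie]; exact Submodule.add_mem _ h₁ h₂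
    | mem hα x hx =>
    induction hy using Submodule.iSup_induction' with
    | zero => simp
    | add x₁ x₂ _ _ h₁ h₂ => rw [lie_add]; exact Submodule.add_mem _ h₁ h₂
    | mem β y hy =>
    induction hy using Submodule.iSup_induction' with
    | zero => simp
    | add x₁ x₂ _ _ h₁ h₂ => rw [lie_add]; exact Submodule.add_mem _ h₁ h₂
    | mem hβ y hy =>
    have hxy := LieAlgebra.lie_mem_genWeightSpace_of_mem_genWeightSpace hx hy
    by_cases h0 : LieAlgebra.rootSpace H
        ((α : LieModule.Weight ℂ H g) + (β : LieModule.Weight ℂ H g) : H → ℂ) = ⊥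
    · have hxy0 : ⁅x, y⁆ = 0 := by
        have h := h0 ▸ (show ⁅x, y⁆ ∈ LieAlgebra.rootSpace H
          ((α : LieModule.Weight ℂ H g) + (β : LieModule.Weight ℂ H g) : H → ℂ) from hxy)
        simpa using h
      rw [hxy0]; exact Submodule.zero_mem _
    · let γ : LieModule.Weight ℂ H g := ⟨_, h0⟩
      have hγ : γ.IsNonZero := by
        intro hz
        have h1 := b.height_reflectionPerm_self α
        have h2 : (LieAlgebra.IsKilling.rootSystem H).reflectionPerm α α = β := by
          apply (LieAlgebra.IsKilling.rootSystem H).root.injective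
          rw [RootPairing.root_reflectionPerm, RootPairing.reflection_apply_self]
          ext h
          have h3 := congr_fun hz h
          simp only [LieAlgebra.IsKilling.rootSystem_root_apply, LinearMap.neg_apply]
          simp [γ] at h3
          simp
          linear_combination -h3
        change b.height ((LieAlgebra.IsKilling.rootSystem H).reflectionPerm α α) = _ at h1
        rw [h2] at h1
        unfold RootPairing.Base.IsPos at hα hβ
        omega
      let γ' : H.root := ⟨γ, by simpa using hγ⟩
      have hγ' : b.IsPos γ' := hα.add hβ (by ext h; simp [γ', γ])
      exact Submodule.mem_iSup_of_mem γ' (Submodule.mem_iSup_of_mem hγ' hxy)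

/-- The Borel subalgebra `𝔟 = 𝔥 ⊕ 𝔫` (`𝔥` normalises `𝔫`, so the subalgebra generated by both is
their sum). -/
def borel (b : (LieAlgebra.IsKilling.rootSystem H).Base) : LieSubalgebra ℂ g :=
  H ⊔ nilradical b

/-- The BGG category `𝓞`. -/
structure CategoryO (b : (LieAlgebra.IsKilling.rootSystem H).Base)
    (M : Type*) [AddCommGroup M] [Module ℂ M] [LieRingModule g M] [LieModule ℂ g M] : Prop where
  /-- `M` is finitely generated as a `𝔤`-module. -/
  finitelyGenerated : ∃ s : Finset M, LieSubmodule.lieSpan ℂ g (s : Set M) = ⊤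
  /-- `M` is `𝔥`-semisimple, i.e. it is the sum of its weight spaces (the sum is then direct). -/
  hSemisimple : ⨆ μ : Dual ℂ H, LieModule.weightSpace M (μ : H → ℂ) = ⊤
  /-- `M` is locally `𝔫`-finite: `U(𝔫) v` is finite-dimensional for each `v`. -/
  locallyFinite : ∀ v : M,
    FiniteDimensional ℂ (LieSubmodule.lieSpan ℂ (nilradical b) ({v} : Set M))

/-- The left ideal of `U(𝔤)` generated by `𝔫` and by all `h - μ(h)` with `h ∈ 𝔥`. -/
def vermaIdeal (b : (LieAlgebra.IsKilling.rootSystem H).Base) (μ : Dual ℂ H) :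
    Submodule (UniversalEnvelopingAlgebra ℂ g) (UniversalEnvelopingAlgebra ℂ g) :=
  Submodule.span _
    ({u | ∃ x ∈ nilradical b, u = UniversalEnvelopingAlgebra.ι ℂ x} ∪
     {u | ∃ h : H, u = UniversalEnvelopingAlgebra.ι ℂ (h : g) -
        algebraMap ℂ (UniversalEnvelopingAlgebra ℂ g) (μ h)})

/-- The Verma module `M(μ) = U(𝔤) ⊗_{U(𝔟)} ℂ_μ`, as the quotient of `U(𝔤)` by the left ideal
generated by `𝔫` and the `h - μ(h)`. -/
def Verma (b : (LieAlgebra.IsKilling.rootSystem H).Base) (μ : Dual ℂ H) : Type _ :=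
  UniversalEnvelopingAlgebra ℂ g ⧸ vermaIdeal b μ

variable (b : (LieAlgebra.IsKilling.rootSystem H).Base) (μ : Dual ℂ H)

instance : AddCommGroup (Verma b μ) :=
  inferInstanceAs (AddCommGroup (UniversalEnvelopingAlgebra ℂ g ⧸ vermaIdeal b μ))

instance : Module (UniversalEnvelopingAlgebra ℂ g) (Verma b μ) :=
  inferInstanceAs (Module (UniversalEnvelopingAlgebra ℂ g)
    (UniversalEnvelopingAlgebra ℂ g ⧸ vermaIdeal b μ))

instance : Module ℂ (Verma b μ) :=
  inferInstanceAs (Module ℂ (UniversalEnvelopingAlgebra ℂ g ⧸ vermaIdeal b μ))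

instance : IsScalarTower ℂ (UniversalEnvelopingAlgebra ℂ g) (Verma b μ) :=
  inferInstanceAs (IsScalarTower ℂ (UniversalEnvelopingAlgebra ℂ g)
    (UniversalEnvelopingAlgebra ℂ g ⧸ vermaIdeal b μ))

/-- `x ∈ 𝔤` acts on `M(μ)` as the corresponding element of `U(𝔤)`. -/
instance : LieRingModule g (Verma b μ) where
  bracket x v := UniversalEnvelopingAlgebra.ι ℂ x • v
  add_lie x y v := by
    rw [map_add, add_smul]
  lie_add x v w := smul_add _ v w
  leibniz_lie x y v := by
    change UniversalEnvelopingAlgebra.ι ℂ x • UniversalEnvelopingAlgebra.ι ℂ y • v =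
      UniversalEnvelopingAlgebra.ι ℂ ⁅x, y⁆ • v +
        UniversalEnvelopingAlgebra.ι ℂ y • UniversalEnvelopingAlgebra.ι ℂ x • v
    rw [LieHom.map_lie, LieRing.of_associative_ring_bracket, sub_smul, mul_smul, mul_smul,
      sub_add_cancel]

instance : LieModule ℂ g (Verma b μ) where
  smul_lie t x v := by
    change UniversalEnvelopingAlgebra.ι ℂ (t • x) • v = t • UniversalEnvelopingAlgebra.ι ℂ x • v
    rw [map_smul, smul_assoc]
  lie_smul t x v := by
    change UniversalEnvelopingAlgebra.ι ℂ x • t • v = t • UniversalEnvelopingAlgebra.ι ℂ x • v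
    rw [← algebraMap_smul (UniversalEnvelopingAlgebra ℂ g) t v, ← mul_smul, ← Algebra.commutes,
      mul_smul, algebraMap_smul]

/-- The unique maximal submodule of `M(μ)`: the sum of all its proper submodules. -/
def vermaRadical : LieSubmodule ℂ g (Verma b μ) := sSup {N | N ≠ ⊤}

/-- The simple highest weight module `L(μ)`, the unique simple quotient of `M(μ)`. -/
abbrev SimpleHW : Type _ := Verma b μ ⧸ vermaRadical b μ

end Setup

section Lattice

variable {k : Type*} [LieRing k] [LieAlgebra ℂ k]
  {M : Type*} [AddCommGroup M] [Module ℂ M] [LieRingModule k M] [LieModule ℂ k M]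

/-- The subquotient `N' / N` for submodules `N ⊆ N'` of `M`. -/
abbrev Subquotient (N N' : LieSubmodule ℂ k M) : Type _ := N' ⧸ N.comap N'.incl

/-- `N = ⨁_j B j` (internally). -/
def IsInternalSum {ι : Type*} (N : LieSubmodule ℂ k M) (B : ι → LieSubmodule ℂ k M) : Prop :=
  iSupIndep B ∧ ⨆ j, B j = N

end Lattice

section Restriction

variable {g : Type*} [LieRing g] [LieAlgebra ℂ g]
  {M : Type*} [AddCommGroup M] [Module ℂ M] [LieRingModule g M] [LieModule ℂ g M]

/-- A `𝔤`-submodule of `M`, viewed as a `𝔭`-submodule of `Res M`. -/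
def resSubmodule (p : LieSubalgebra ℂ g) (N : LieSubmodule ℂ g M) : LieSubmodule ℂ p M where
  __ := N.toSubmodule
  lie_mem {x} _ hm := N.lie_mem (x := (x : g)) hm

variable [FiniteDimensional ℂ g] [LieAlgebra.IsSemisimple ℂ g]
  {H : LieSubalgebra ℂ g} [H.IsCartanSubalgebra]

/-- `0 = F 0 ⊂ F 1 ⊂ ⋯ ⊂ F n = A` is a filtration of the `𝔭`-submodule `A` of `Res M`, with each
subquotient isomorphic to `Res L(μ)` for some `μ`. -/
structure IsSimpleResFiltration (b : (LieAlgebra.IsKilling.rootSystem H).Base)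
    (p : LieSubalgebra ℂ g) (A : LieSubmodule ℂ p M) {n : ℕ}
    (F : Fin (n + 1) → LieSubmodule ℂ p M) : Prop where
  zero : F 0 = ⊥
  last : F (Fin.last n) = A
  lt_succ : ∀ i : Fin n, F i.castSucc < F i.succ
  subquotient : ∀ i : Fin n, ∃ μ : Dual ℂ H,
    Nonempty (Subquotient (F i.castSucc) (F i.succ) ≃ₗ⁅ℂ, p⁆ SimpleHW b μ)

end Restriction

/-- `0 = N 0 ⊂ N 1 ⊂ ⋯ ⊂ N l = M` is a composition series of the module `M`. -/
structure IsCompSeries {k : Type*} [LieRing k] [LieAlgebra ℂ k]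
    {M : Type*} [AddCommGroup M] [Module ℂ M] [LieRingModule k M] [LieModule ℂ k M] {l : ℕ}
    (N : Fin (l + 1) → LieSubmodule ℂ k M) : Prop where
  zero : N 0 = ⊥
  last : N (Fin.last l) = ⊤
  covBy : ∀ i : Fin l, N i.castSucc ⋖ N i.succ

end CatO

end

/-! The projections `π j` of `Res M` onto its summands `A j` commute with `𝔭`, hence with `𝔟`,
though not in general with `𝔤`. The composition series is built upwards through `𝔤`-submodules `N`
stable under every `π j`. If `N ≠ M`, the `π j` act on `M/N`. Call the real part of `μ(h₀)` the
height of `μ`, where `h₀ ∈ 𝔥` takes on each root its height. Among the singular vectors of `M/N`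
take `v` with weight `μ` of least height. Some `w = π k v` is nonzero, and it is again singular of
weight `μ`.

By the triangular decomposition, `U(𝔤)w` is `ℂw` plus weight vectors of height at most that of `μ`
minus one. Every nonzero `𝔟`-stable subspace contains a singular vector, so by minimality none lies
in this lower part. Two subspaces must therefore vanish: any proper submodule of `U(𝔤)w`, and the
image of `U(𝔤)w` under `π k - 1`, which kills `w`. So `U(𝔤)w ≅ L(μ)`, and `π k` fixes it pointwise
(`IsSingular.isAtom_and_eqOn`). Its preimage `N'` is again stable, meets the summands other than `A
k` exactly as `N` does, and satisfies `(N' ∩ A k)/(N ∩ A k) ≅ Res L(μ)`. The distinct intersections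
`N ∩ A j` along the series are the filtrations.

Two finiteness facts are needed: a least height exists, and the construction stops. Both come from
the Casimir operator. It acts on singular vectors by a quadratic function of the weight and
satisfies a polynomial equation on `M`. The weights of `M` lie in finitely many cosets of the root
lattice, on each of which that function takes a given value finitely often. Hence one finite set
contains the weights of singular vectors of all quotients of `M`
(`CategoryO.finite_singular_weights`). Cutting `M` below these weights leaves a finite-dimensional
space that distinguishes nested submodules, so `M` is Noetherian (`CategoryO.wellFoundedGT`). -/

set_option linter.unusedSectionVars false

noncomputable section

namespace CatO

/-! ### Triangular decomposition and the height element -/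

section Roots

variable {g : Type*} [LieRing g] [LieAlgebra ℂ g] [FiniteDimensional ℂ g] [LieAlgebra.IsSemisimple ℂ g]
  {H : LieSubalgebra ℂ g} [H.IsCartanSubalgebra]

/-- The sum of the root spaces of the negative roots. -/
def negPart (b : (LieAlgebra.IsKilling.rootSystem H).Base) : Submodule ℂ g :=
  ⨆ (α : H.root) (_ : ¬ b.IsPos α), (LieAlgebra.rootSpace H (α : LieModule.Weight ℂ H g)).toSubmodule

/-- The simple roots form a basis of `𝔥*`; the functional equal to 1 on each of them is evaluation
at a point of `𝔥`. Its real part grades weights that need not be integral. -/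
theorem exists_height_element (b : (LieAlgebra.IsKilling.rootSystem H).Base) :
    ∃ h₀ : H, ∀ α : H.root, (α : LieModule.Weight ℂ H g) h₀ = (b.height α : ℂ) := by
  let φ : Dual ℂ (Dual ℂ H) := b.toWeightBasis.constr ℂ (fun _ ↦ (1 : ℂ))
  obtain ⟨h₀, hh⟩ := (Module.evalEquiv ℂ H).surjective φ
  refine ⟨h₀, fun α ↦ ?_⟩
  have key : ∀ x : Dual ℂ H, x h₀ = φ x := fun x ↦ by rw [← hh]; rfl
  have h1 : (α : LieModule.Weight ℂ H g) h₀ = φ ((LieAlgebra.IsKilling.rootSystem H).root α) := by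
    rw [← key]; rfl
  obtain ⟨f, -, -, hf⟩ := b.exists_root_eq_sum_int α
  rw [h1, RootPairing.Base.height_eq_sum hf, hf, map_sum, Int.cast_sum]
  refine Finset.sum_congr rfl fun j hj ↦ ?_
  have h2 : φ ((LieAlgebra.IsKilling.rootSystem H).root j) = 1 := by
    have := b.toWeightBasis.constr_basis ℂ (fun _ ↦ (1 : ℂ)) ⟨j, hj⟩
    rwa [b.toWeightBasis_apply] at this
  rw [map_zsmul, h2]; simp

/-- An element of `𝔥` on which each root takes its height as value. -/
def heightElement (b : (LieAlgebra.IsKilling.rootSystem H).Base) : H :=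
  (exists_height_element b).choose

theorem root_heightElement (b : (LieAlgebra.IsKilling.rootSystem H).Base) (α : H.root) :
    (α : LieModule.Weight ℂ H g) (heightElement b) = (b.height α : ℂ) :=
  (exists_height_element b).choose_spec α

theorem mem_nilradical_of_mem_rootSpace (b : (LieAlgebra.IsKilling.rootSystem H).Base)
    {α : H.root} (hα : b.IsPos α) {x : g}
    (hx : x ∈ LieAlgebra.rootSpace H (α : LieModule.Weight ℂ H g)) : x ∈ nilradical b :=
  Submodule.mem_iSup_of_mem (p := fun α : H.root ↦ ⨆ (_ : b.IsPos α),
    (LieAlgebra.rootSpace H (α : LieModule.Weight ℂ H g)).toSubmodule) α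
    (Submodule.mem_iSup_of_mem hα hx)

theorem negPart_sup_cartan_sup_nilradical (b : (LieAlgebra.IsKilling.rootSystem H).Base) :
    negPart b ⊔ H.toSubmodule ⊔ (nilradical b).toSubmodule = ⊤ := by
  have h := congr_arg LieSubmodule.toSubmodule (LieAlgebra.cartan_sup_iSup_rootSpace_eq_top
    (K := ℂ) (L := g) (H := H))
  rw [LieSubmodule.top_toSubmodule] at h
  rw [eq_top_iff, ← h, LieSubmodule.sup_toSubmodule, sup_le_iff]
  refine ⟨le_sup_of_le_left le_sup_right, ?_⟩
  simp only [LieSubmodule.iSup_toSubmodule]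
  refine iSup₂_le fun α hα ↦ ?_
  let α' : H.root := ⟨α, by simpa using hα⟩
  by_cases hp : b.IsPos α'
  · exact le_sup_of_le_right fun x hx ↦ mem_nilradical_of_mem_rootSpace b hp hx
  · exact le_sup_of_le_left (le_sup_of_le_left
      (le_iSup₂_of_le (f := fun (α : H.root) (_ : ¬ b.IsPos α) ↦
        (LieAlgebra.rootSpace H (α : LieModule.Weight ℂ H g)).toSubmodule) α' hp le_rfl))

theorem nilradical_induction (b : (LieAlgebra.IsKilling.rootSystem H).Base) {P : g → Prop}
    (zero : P 0) (add : ∀ x y, P x → P y → P (x + y))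
    (root : ∀ α : H.root, b.IsPos α →
      ∀ x ∈ LieAlgebra.rootSpace H (α : LieModule.Weight ℂ H g), P x)
    {x : g} (hx : x ∈ nilradical b) : P x := by
  change x ∈ ⨆ (α : H.root) (_ : b.IsPos α),
    (LieAlgebra.rootSpace H (α : LieModule.Weight ℂ H g)).toSubmodule at hx
  refine Submodule.iSup_induction _ (motive := P) hx (fun α y hy ↦ ?_) zero add
  exact Submodule.iSup_induction _ (motive := P) hy (fun hα z hz ↦ root α hα z hz) zero add

theorem negPart_induction (b : (LieAlgebra.IsKilling.rootSystem H).Base) {P : g → Prop}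
    (zero : P 0) (add : ∀ x y, P x → P y → P (x + y))
    (root : ∀ α : H.root, ¬ b.IsPos α →
      ∀ x ∈ LieAlgebra.rootSpace H (α : LieModule.Weight ℂ H g), P x)
    {x : g} (hx : x ∈ negPart b) : P x := by
  refine Submodule.iSup_induction _ (motive := P) hx (fun α y hy ↦ ?_) zero add
  exact Submodule.iSup_induction _ (motive := P) hy (fun hα z hz ↦ root α hα z hz) zero add

theorem induction_on_roots (b : (LieAlgebra.IsKilling.rootSystem H).Base) {P : g → Prop}
    (add : ∀ x y, P x → P y → P (x + y))
    (neg : ∀ x ∈ negPart b, P x) (cartan : ∀ h : H, P h) (pos : ∀ x ∈ nilradical b, P x)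
    (x : g) : P x := by
  have hx : x ∈ negPart b ⊔ H.toSubmodule ⊔ (nilradical b).toSubmodule := by
    rw [negPart_sup_cartan_sup_nilradical]; trivial
  obtain ⟨y, hy, z, hz, rfl⟩ := Submodule.mem_sup.1 hx
  obtain ⟨u, hu, v, hv, rfl⟩ := Submodule.mem_sup.1 hy
  exact add _ _ (add _ _ (neg u hu) (cartan ⟨v, hv⟩)) (pos z hz)

theorem lie_cartan_mem_nilradical (b : (LieAlgebra.IsKilling.rootSystem H).Base) (h : H) {x : g}
    (hx : x ∈ nilradical b) : ⁅(h : g), x⁆ ∈ nilradical b := by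
  refine nilradical_induction b (P := fun x ↦ ⁅(h : g), x⁆ ∈ nilradical b) (by simp)
    (fun x y hx hy ↦ by rw [lie_add]; exact add_mem hx hy) (fun α hα x hx ↦ ?_) hx
  exact mem_nilradical_of_mem_rootSpace b hα (LieSubmodule.lie_mem _ (x := h) hx)

end Roots

/-! ### Weight spaces and singular vectors -/

section Weights

variable {g : Type*} [LieRing g] [LieAlgebra ℂ g] [FiniteDimensional ℂ g] [LieAlgebra.IsSemisimple ℂ g]
  {H : LieSubalgebra ℂ g} [H.IsCartanSubalgebra]
  {M : Type*} [AddCommGroup M] [Module ℂ M] [LieRingModule g M] [LieModule ℂ g M]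

theorem mem_weightSpace_iff {μ : Dual ℂ H} {v : M} :
    v ∈ LieModule.weightSpace M (μ : H → ℂ) ↔ ∀ h : H, ⁅(h : g), v⁆ = μ h • v :=
  LieModule.mem_weightSpace _ _

theorem lie_mem_weightSpace {α : LieModule.Weight ℂ H g} {x : g} (hx : x ∈ LieAlgebra.rootSpace H α)
    {μ : Dual ℂ H} {v : M} (hv : v ∈ LieModule.weightSpace M (μ : H → ℂ)) :
    ⁅x, v⁆ ∈ LieModule.weightSpace M ((μ + α.toLinear : Dual ℂ H) : H → ℂ) := by
  rw [mem_weightSpace_iff] at hv ⊢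
  intro h
  have := LieAlgebra.IsKilling.lie_eq_smul_of_mem_rootSpace hx h
  change ⁅(h : g), x⁆ = _ at this
  rw [leibniz_lie, hv, this, smul_lie, lie_smul, ← add_smul]
  simp [add_comm]

/-- A singular vector of weight `μ`: a weight vector that is annihilated by `𝔫`. -/
structure IsSingular (b : (LieAlgebra.IsKilling.rootSystem H).Base) (μ : Dual ℂ H) (v : M) :
    Prop where
  weight : v ∈ LieModule.weightSpace M (μ : H → ℂ)
  lie_eq_zero : ∀ x ∈ nilradical b, ⁅x, v⁆ = 0

/-- The sum of the weight spaces with weights in `Λ`. -/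
def weightSum (H : LieSubalgebra ℂ g) [H.IsCartanSubalgebra] (M : Type*) [AddCommGroup M]
    [Module ℂ M] [LieRingModule g M] [LieModule ℂ g M] (Λ : Set (Dual ℂ H)) : Submodule ℂ M :=
  ⨆ μ ∈ Λ, (LieModule.weightSpace M (μ : H → ℂ)).toSubmodule

theorem weightSpace_le_weightSum {Λ : Set (Dual ℂ H)} {μ : Dual ℂ H} (hμ : μ ∈ Λ) :
    (LieModule.weightSpace M (μ : H → ℂ)).toSubmodule ≤ weightSum H M Λ :=
  le_iSup₂_of_le (f := fun (μ : Dual ℂ H) (_ : μ ∈ Λ) ↦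
    (LieModule.weightSpace M (μ : H → ℂ)).toSubmodule) μ hμ le_rfl

theorem weightSum_mono {Λ Λ' : Set (Dual ℂ H)} (h : Λ ⊆ Λ') : weightSum H M Λ ≤ weightSum H M Λ' :=
  biSup_mono h

theorem weightSum_induction {Λ : Set (Dual ℂ H)} {P : M → Prop}
    (zero : P 0) (add : ∀ x y, P x → P y → P (x + y))
    (weight : ∀ μ ∈ Λ, ∀ v ∈ LieModule.weightSpace M (μ : H → ℂ), P v)
    {v : M} (hv : v ∈ weightSum H M Λ) : P v := by
  refine Submodule.iSup_induction _ (motive := P) hv (fun α y hy ↦ ?_) zero add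
  exact Submodule.iSup_induction _ (motive := P) hy (fun hα z hz ↦ weight α hα z hz) zero add

theorem iSupIndep_weightSpace (N : Type*) [AddCommGroup N] [Module ℂ N] [LieRingModule H N]
    [LieModule ℂ H N] :
    iSupIndep fun μ : Dual ℂ H ↦ (LieModule.weightSpace N (μ : H → ℂ)).toSubmodule := by
  have h := (LieSubmodule.iSupIndep_toSubmodule.2 (LieModule.iSupIndep_genWeightSpace ℂ H N)).comp
    (f := fun μ : Dual ℂ H ↦ (μ : H → ℂ)) DFunLike.coe_injective
  exact h.mono fun μ ↦ LieModule.weightSpace_le_genWeightSpace N (μ : H → ℂ)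

theorem eq_zero_of_mem_weightSum {Λ : Set (Dual ℂ H)} {μ : Dual ℂ H} (hμ : μ ∉ Λ) {v : M}
    (hv : v ∈ LieModule.weightSpace M (μ : H → ℂ)) (hΛ : v ∈ weightSum H M Λ) : v = 0 :=
  Submodule.disjoint_def.1 ((iSupIndep_weightSpace (H := H) M).disjoint_biSup hμ) v hv hΛ

/-- A subspace that is stable under `𝔥` contains the weight components of its elements. -/
theorem exists_weight_vector_mem (hM : weightSum H M Set.univ = ⊤) {P : Submodule ℂ M}
    (hP : ∀ h : H, ∀ v ∈ P, ⁅(h : g), v⁆ ∈ P) (hne : P ≠ ⊥) :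
    ∃ (μ : Dual ℂ H) (v : M), v ∈ P ∧ v ≠ 0 ∧ v ∈ LieModule.weightSpace M (μ : H → ℂ) := by
  by_contra! hcon
  apply hne
  rw [eq_bot_iff]
  intro u hu
  let P' : LieSubmodule ℂ H M := { P with lie_mem := fun {h m} hm ↦ hP h m hm }
  have hind := iSupIndep_weightSpace (H := H) (M ⧸ P')
  -- The weight components of `u` sum to zero in `M ⧸ P'`, where weight spaces are still
  -- independent, so each component lies in `P`.
  have hu' : u ∈ ⨆ μ : Dual ℂ H, (LieModule.weightSpace M (μ : H → ℂ)).toSubmodule := by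
    have : u ∈ weightSum H M Set.univ := by rw [hM]; trivial
    simpa [weightSum] using this
  obtain ⟨f, hf⟩ := (Submodule.mem_iSup_iff_exists_finsupp _ _).1 hu'
  obtain ⟨hf, hfu⟩ := hf
  have hq : ∀ μ : Dual ℂ H, LieSubmodule.Quotient.mk' P' (f μ) ∈
      (LieModule.weightSpace (M ⧸ P') (μ : H → ℂ)).toSubmodule := by
    intro μ
    have h1 := (LieModule.mem_weightSpace _ _).1 (hf μ)
    refine (LieModule.mem_weightSpace _ _).2 fun h ↦ ?_
    rw [← LieModuleHom.map_lie, h1, map_smul]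
  have hsum : ∑ μ ∈ f.support, LieSubmodule.Quotient.mk' P' (f μ) = 0 := by
    rw [← map_sum]
    change LieSubmodule.Quotient.mk' P' (f.sum fun _ x ↦ x) = 0
    rw [hfu]; exact (LieSubmodule.Quotient.mk_eq_zero _).2 hu
  have hz : ∀ μ ∈ f.support, LieSubmodule.Quotient.mk' P' (f μ) = 0 :=
    (iSupIndep_iff_finsetSum_eq_zero_imp_eq_zero _).1 hind f.support _ (fun μ _ ↦ hq μ) hsum
  rw [Submodule.mem_bot, ← hfu]
  refine Finset.sum_eq_zero fun μ hμ ↦ ?_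
  by_contra hne
  exact hcon μ (f μ) ((LieSubmodule.Quotient.mk_eq_zero _).1 (hz μ hμ)) hne (hf μ)

end Weights

/-! ### Truncation by height and submodules generated by `𝔟`-stable subspaces -/

section LowerPart

variable {g : Type*} [LieRing g] [LieAlgebra ℂ g] [FiniteDimensional ℂ g] [LieAlgebra.IsSemisimple ℂ g]
  {H : LieSubalgebra ℂ g} [H.IsCartanSubalgebra]
  {M : Type*} [AddCommGroup M] [Module ℂ M] [LieRingModule g M] [LieModule ℂ g M]

theorem lie_cartan_mem_weightSum {Λ : Set (Dual ℂ H)} (h : H) {v : M} (hv : v ∈ weightSum H M Λ) :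
    ⁅(h : g), v⁆ ∈ weightSum H M Λ := by
  refine weightSum_induction (P := fun v ↦ ⁅(h : g), v⁆ ∈ weightSum H M Λ) (by simp)
    (fun x y hx hy ↦ by rw [lie_add]; exact add_mem hx hy) (fun μ hμ v hv ↦ ?_) hv
  rw [mem_weightSpace_iff.1 hv h]
  exact Submodule.smul_mem _ _ (weightSpace_le_weightSum hμ hv)

theorem map_mem_weightSum {M' : Type*} [AddCommGroup M'] [Module ℂ M'] [LieRingModule g M']
    [LieModule ℂ g M'] {f : M →ₗ[ℂ] M'} (hf : ∀ (h : H) (v : M), f ⁅(h : g), v⁆ = ⁅(h : g), f v⁆)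
    {Λ : Set (Dual ℂ H)} {v : M} (hv : v ∈ weightSum H M Λ) : f v ∈ weightSum H M' Λ := by
  refine weightSum_induction (P := fun v ↦ f v ∈ weightSum H M' Λ) (by simp)
    (fun x y hx hy ↦ by rw [map_add]; exact add_mem hx hy) (fun μ hμ v hv ↦ ?_) hv
  refine weightSpace_le_weightSum hμ (mem_weightSpace_iff.2 fun h ↦ ?_)
  rw [← hf, mem_weightSpace_iff.1 hv, map_smul]

theorem weightSum_eq_top_of_surjective {M' : Type*} [AddCommGroup M'] [Module ℂ M']
    [LieRingModule g M'] [LieModule ℂ g M'] {f : M →ₗ⁅ℂ, g⁆ M'} (hf : Function.Surjective f)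
    {Λ : Set (Dual ℂ H)} (h : weightSum H M Λ = ⊤) : weightSum H M' Λ = ⊤ := by
  rw [eq_top_iff]
  intro v _
  obtain ⟨u, rfl⟩ := hf v
  exact map_mem_weightSum (f := (f : M →ₗ[ℂ] M')) (fun h v ↦ f.map_lie _ _)
    (show u ∈ weightSum H M Λ by rw [h]; trivial)

variable (M) in
/-- The sum of the weight spaces whose weight has height at most `c`. -/
def lowerPart (b : (LieAlgebra.IsKilling.rootSystem H).Base) (c : ℝ) : Submodule ℂ M :=
  weightSum H M {μ | (μ (heightElement b)).re ≤ c}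

variable (b : (LieAlgebra.IsKilling.rootSystem H).Base)

theorem lowerPart_mono {c c' : ℝ} (h : c ≤ c') : lowerPart M b c ≤ lowerPart M b c' :=
  weightSum_mono fun _ hμ ↦ le_trans hμ h

theorem eq_zero_of_mem_lowerPart {c : ℝ} {μ : Dual ℂ H} (hμ : c < (μ (heightElement b)).re) {v : M}
    (hv : v ∈ LieModule.weightSpace M (μ : H → ℂ)) (hc : v ∈ lowerPart M b c) : v = 0 :=
  eq_zero_of_mem_weightSum (by simpa using hμ) hv hc

/-- Root heights are nonzero integers, so a root that is not positive lowers the height by at least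
one. -/
theorem lie_mem_lowerPart {c : ℝ} {x : g} (hx : x ∈ negPart b) {v : M} (hv : v ∈ lowerPart M b c) :
    ⁅x, v⁆ ∈ lowerPart M b (c - 1) := by
  refine negPart_induction b (P := fun x ↦ ⁅x, v⁆ ∈ lowerPart M b (c - 1)) (by simp)
    (fun x y hx hy ↦ by rw [add_lie]; exact add_mem hx hy) (fun α hα x hx ↦ ?_) hx
  refine weightSum_induction (P := fun v ↦ ⁅x, v⁆ ∈ lowerPart M b (c - 1)) (by simp)
    (fun x y hx hy ↦ by rw [lie_add]; exact add_mem hx hy) (fun μ hμ v hv ↦ ?_) hv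
  refine weightSpace_le_weightSum ?_ (lie_mem_weightSpace hx hv)
  have h1 : b.height α ≤ -1 := by
    have := b.height_ne_zero α
    rw [RootPairing.Base.isPos_iff] at hα
    omega
  have h2 : ((α : LieModule.Weight ℂ H g) (heightElement b)).re ≤ -1 := by
    rw [root_heightElement, Complex.intCast_re]
    exact_mod_cast h1
  simp only [Set.mem_ofPred_eq, LinearMap.add_apply, Complex.add_re,
    LieModule.Weight.toLinear_apply] at hμ ⊢
  linarith

/-- The subspace `V + 𝔫⁻ W`. -/
def lowerStep (V W : Submodule ℂ M) : Submodule ℂ M :=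
  V ⊔ Submodule.map₂ (LieModule.toEnd ℂ g M : g →ₗ[ℂ] M →ₗ[ℂ] M) (negPart b) W

theorem lie_mem_lowerStep {V W : Submodule ℂ M} {x : g} (hx : x ∈ negPart b) {v : M} (hv : v ∈ W) :
    ⁅x, v⁆ ∈ lowerStep b V W :=
  Submodule.mem_sup_right
    (Submodule.apply_mem_map₂ (LieModule.toEnd ℂ g M : g →ₗ[ℂ] M →ₗ[ℂ] M) hx hv)

theorem lowerStep_le {V W P : Submodule ℂ M} (hV : V ≤ P)
    (h : ∀ x ∈ negPart b, ∀ v ∈ W, ⁅x, v⁆ ∈ P) : lowerStep b V W ≤ P :=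
  sup_le hV (Submodule.map₂_le.2 h)

theorem lowerStep_mono {V W W' : Submodule ℂ M} (h : W ≤ W') :
    lowerStep b V W ≤ lowerStep b V W' :=
  sup_le_sup le_rfl (Submodule.map₂_le_map₂_right h)

/-- The span of the vectors `f₁ ⋯ fᵣ v` with `v ∈ V`, `fᵢ ∈ 𝔫⁻` and `r ≤ k`. -/
def lowerIterate (V : Submodule ℂ M) : ℕ → Submodule ℂ M
  | 0 => V
  | k + 1 => lowerStep b V (lowerIterate V k)

theorem lowerIterate_le_succ (V : Submodule ℂ M) (k : ℕ) :
    lowerIterate b V k ≤ lowerIterate b V (k + 1) := by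
  induction k with
  | zero => exact le_sup_left
  | succ k ih => exact lowerStep_mono b ih

theorem fg_lowerIterate {V : Submodule ℂ M} (hV : V.FG) (k : ℕ) : (lowerIterate b V k).FG := by
  induction k with
  | zero => exact hV
  | succ k ih => exact hV.sup (Submodule.FG.map₂ _ (IsNoetherian.noetherian _) ih)

variable {b}

/-- `V` is a `𝔟`-stable subspace. -/
structure IsBorelStable (b : (LieAlgebra.IsKilling.rootSystem H).Base) (V : Submodule ℂ M) :
    Prop where
  cartan : ∀ h : H, ∀ v ∈ V, ⁅(h : g), v⁆ ∈ V
  nilradical : ∀ x ∈ CatO.nilradical b, ∀ v ∈ V, ⁅x, v⁆ ∈ V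

theorem lie_mem_lowerStep_of_isBorelStable {V W : Submodule ℂ M} (hW : IsBorelStable b W)
    (hle : W ≤ lowerStep b V W) (x : g) {v : M} (hv : v ∈ W) : ⁅x, v⁆ ∈ lowerStep b V W := by
  refine induction_on_roots b (P := fun x ↦ ⁅x, v⁆ ∈ lowerStep b V W)
    (fun x y hx hy ↦ by rw [add_lie]; exact add_mem hx hy)
    (fun x hx ↦ lie_mem_lowerStep b hx hv) (fun h ↦ hle (hW.cartan h v hv))
    (fun x hx ↦ hle (hW.nilradical x hx v hv)) x

/-- In `y(xu) = [y,x]u + x(yu)` the bracket `[y,x]` may be any element of `𝔤`; the previous lemma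
absorbs it. This gives the consequence of Poincaré–Birkhoff–Witt that is needed, namely `U(𝔤)V =
U(𝔫⁻)V`. -/
theorem isBorelStable_lowerStep {V W : Submodule ℂ M} (hV : IsBorelStable b V)
    (hW : IsBorelStable b W) (hle : W ≤ lowerStep b V W) : IsBorelStable b (lowerStep b V W) := by
  have key : ∀ y : g, (∀ v ∈ V, ⁅y, v⁆ ∈ V) → (∀ v ∈ W, ⁅y, v⁆ ∈ W) →
      ∀ v ∈ lowerStep b V W, ⁅y, v⁆ ∈ lowerStep b V W := by
    intro y hyV hyW v hv
    refine lowerStep_le b (P := (lowerStep b V W).comap (LieModule.toEnd ℂ g M y))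
      (fun u hu ↦ Submodule.mem_sup_left (hyV u hu)) (fun x hx u hu ↦ ?_) hv
    change ⁅y, ⁅x, u⁆⁆ ∈ lowerStep b V W
    rw [leibniz_lie]
    exact add_mem (lie_mem_lowerStep_of_isBorelStable hW hle _ hu)
      (lie_mem_lowerStep b hx (hyW u hu))
  exact ⟨fun h ↦ key h (hV.cartan h) (hW.cartan h),
    fun x hx ↦ key x (hV.nilradical x hx) (hW.nilradical x hx)⟩

theorem isBorelStable_lowerIterate {V : Submodule ℂ M} (hV : IsBorelStable b V) (k : ℕ) :
    IsBorelStable b (lowerIterate b V k) := by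
  induction k with
  | zero => exact hV
  | succ k ih => exact isBorelStable_lowerStep hV ih (lowerIterate_le_succ b V k)

theorem lieSpan_le_iSup_lowerIterate {V : Submodule ℂ M} (hV : IsBorelStable b V) :
    (LieSubmodule.lieSpan ℂ g (V : Set M)).toSubmodule ≤ ⨆ k, lowerIterate b V k := by
  let N : LieSubmodule ℂ g M :=
    { (⨆ k, lowerIterate b V k) with
      lie_mem := by
        intro x m hm
        have hm' : m ∈ ⨆ k, lowerIterate b V k := hm
        refine Submodule.iSup_induction _ (motive := fun m ↦ ⁅x, m⁆ ∈ ⨆ k, lowerIterate b V k)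
          hm' (fun k v hv ↦ ?_) (by simp)
          (fun u v hu hv ↦ by rw [lie_add]; exact add_mem hu hv)
        exact Submodule.mem_iSup_of_mem (k + 1) (lie_mem_lowerStep_of_isBorelStable
          (isBorelStable_lowerIterate hV k) (lowerIterate_le_succ b V k) x hv) }
  exact (LieSubmodule.lieSpan_le (N := N)).2 fun v hv ↦
    Submodule.mem_iSup_of_mem (p := fun k ↦ lowerIterate b V k) 0 hv

theorem lowerIterate_le_lowerPart {V : Submodule ℂ M} {c : ℝ} (hc : V ≤ lowerPart M b c) (k : ℕ) :
    lowerIterate b V k ≤ lowerPart M b c := by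
  induction k with
  | zero => exact hc
  | succ k ih =>
    exact lowerStep_le b hc fun x hx v hv ↦
      lowerPart_mono b (by linarith) (lie_mem_lowerPart b hx (ih hv))

/-- A product of more than `j` factors from `𝔫⁻` lowers heights by more than `j`, so modulo the
lower part only the first `j` iterates matter. -/
theorem lowerIterate_le_sup_lowerPart {V : Submodule ℂ M} {c : ℝ} (hc : V ≤ lowerPart M b c)
    (j k : ℕ) : lowerIterate b V k ≤ lowerIterate b V j ⊔ lowerPart M b (c - j) := by
  induction j generalizing k with
  | zero => simpa using le_sup_of_le_right (lowerIterate_le_lowerPart hc k)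
  | succ j ih =>
    cases k with
    | zero => exact le_sup_of_le_left le_sup_left
    | succ k =>
      refine lowerStep_le b (le_sup_of_le_left le_sup_left) fun x hx v hv ↦ ?_
      obtain ⟨u, hu, w, hw, rfl⟩ := Submodule.mem_sup.1 (ih k hv)
      rw [lie_add]
      refine Submodule.add_mem_sup (lie_mem_lowerStep b hx hu) ?_
      have := lie_mem_lowerPart b hx hw
      rwa [sub_sub, ← Nat.cast_succ] at this

theorem lieSpan_le_lowerIterate_sup_lowerPart {V : Submodule ℂ M} (hV : IsBorelStable b V) {c : ℝ}
    (hc : V ≤ lowerPart M b c) (j : ℕ) :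
    (LieSubmodule.lieSpan ℂ g (V : Set M)).toSubmodule ≤
      lowerIterate b V j ⊔ lowerPart M b (c - j) :=
  (lieSpan_le_iSup_lowerIterate hV).trans (iSup_le (lowerIterate_le_sup_lowerPart hc j))

theorem lieSpan_le_lowerPart {V : Submodule ℂ M} (hV : IsBorelStable b V) {c : ℝ}
    (hc : V ≤ lowerPart M b c) :
    (LieSubmodule.lieSpan ℂ g (V : Set M)).toSubmodule ≤ lowerPart M b c :=
  (lieSpan_le_iSup_lowerIterate hV).trans (iSup_le (lowerIterate_le_lowerPart hc))

theorem lieSpan_le_sup_lowerPart {V : Submodule ℂ M} (hV : IsBorelStable b V) {c : ℝ}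
    (hc : V ≤ lowerPart M b c) :
    (LieSubmodule.lieSpan ℂ g (V : Set M)).toSubmodule ≤ V ⊔ lowerPart M b (c - 1) := by
  refine (lieSpan_le_lowerIterate_sup_lowerPart hV hc 1).trans (sup_le ?_ (by simp))
  exact lowerStep_le b le_sup_left fun x hx v hv ↦
    Submodule.mem_sup_right (lie_mem_lowerPart b hx (hc hv))

/-! ### Highest weight modules -/

theorem IsSingular.isBorelStable_span {μ : Dual ℂ H} {w : M} (hw : IsSingular b μ w) :
    IsBorelStable b (ℂ ∙ w) := by
  constructor
  · intro h v hv
    obtain ⟨a, rfl⟩ := Submodule.mem_span_singleton.1 hv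
    rw [lie_smul, mem_weightSpace_iff.1 hw.weight]
    exact Submodule.smul_mem _ _ (Submodule.smul_mem _ _ (Submodule.mem_span_singleton_self w))
  · intro x hx v hv
    obtain ⟨a, rfl⟩ := Submodule.mem_span_singleton.1 hv
    rw [lie_smul, hw.lie_eq_zero x hx, smul_zero]
    exact zero_mem _

theorem IsSingular.span_le_lowerPart {μ : Dual ℂ H} {w : M} (hw : IsSingular b μ w) :
    (ℂ ∙ w) ≤ lowerPart M b (μ (heightElement b)).re :=
  (Submodule.span_singleton_le_iff_mem _ _).2 (weightSpace_le_weightSum (by simp) hw.weight)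

theorem lieSpan_span_singleton (w : M) :
    LieSubmodule.lieSpan ℂ g ((ℂ ∙ w : Submodule ℂ M) : Set M) = LieSubmodule.lieSpan ℂ g {w} := by
  refine le_antisymm (LieSubmodule.lieSpan_le.2 ?_)
    (LieSubmodule.lieSpan_mono (by simp))
  exact LieSubmodule.submodule_span_le_lieSpan

theorem IsSingular.lieSpan_le {μ : Dual ℂ H} {w : M} (hw : IsSingular b μ w) :
    (LieSubmodule.lieSpan ℂ g {w}).toSubmodule ≤
      (ℂ ∙ w) ⊔ lowerPart M b ((μ (heightElement b)).re - 1) := by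
  rw [← lieSpan_span_singleton]
  exact lieSpan_le_sup_lowerPart hw.isBorelStable_span hw.span_le_lowerPart

/-- A submodule of a highest weight module that does not contain the highest weight vector lies in
the sum of the lower weight spaces. -/
theorem IsSingular.le_lowerPart {μ : Dual ℂ H} {w : M} (hw : IsSingular b μ w)
    {N : LieSubmodule ℂ g M} (hN : N < LieSubmodule.lieSpan ℂ g {w}) :
    N.toSubmodule ≤ lowerPart M b ((μ (heightElement b)).re - 1) := by
  intro v hv
  obtain ⟨u, hu, t, ht, rfl⟩ := Submodule.mem_sup.1 (hw.lieSpan_le (hN.le hv))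
  obtain ⟨a, rfl⟩ := Submodule.mem_span_singleton.1 hu
  suffices h : a = 0 by simpa [h] using ht
  by_contra ha
  let q := LieSubmodule.Quotient.mk' N
  -- In `M ⧸ N` the vector `a • w` has weight `μ` but equals `-t`, which has only lower weights.
  have h1 : q (a • w) = 0 := by
    have hz : q (a • w) = - q t := by
      rw [eq_neg_iff_add_eq_zero, ← map_add]
      exact (LieSubmodule.Quotient.mk_eq_zero _).2 hv
    refine eq_zero_of_mem_lowerPart b (μ := μ) (c := (μ (heightElement b)).re - 1)
      (by linarith) (mem_weightSpace_iff.2 fun h ↦ ?_) ?_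
    · rw [← LieModuleHom.map_lie, lie_smul, mem_weightSpace_iff.1 hw.weight, smul_comm, map_smul]
    · rw [hz]
      exact neg_mem (map_mem_weightSum (f := (q : M →ₗ[ℂ] M ⧸ N)) (fun h v ↦ q.map_lie _ _) ht)
  have h2 : w ∈ N := by
    rw [map_smul] at h1
    exact (LieSubmodule.Quotient.mk_eq_zero _).1 ((smul_eq_zero_iff_right ha).1 h1)
  exact hN.not_ge (LieSubmodule.lieSpan_le.2 (by simpa using h2))

/-- Every nonzero `𝔟`-stable subspace contains a singular vector. -/
theorem exists_isSingular_mem (hM : weightSum H M Set.univ = ⊤) {c : ℝ}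
    (hc : lowerPart M b c = ⊤) {P : Submodule ℂ M} (hP : IsBorelStable b P) (hne : P ≠ ⊥) :
    ∃ (μ : Dual ℂ H) (v : M), v ∈ P ∧ v ≠ 0 ∧ IsSingular b μ v := by
  obtain ⟨μ, v, hvP, hv0, hv⟩ := exists_weight_vector_mem hM hP.cartan hne
  -- `k` bounds how often `v` can be raised: each positive root vector adds at least 1 to the
  -- height, and no weight has height above `c`.
  obtain ⟨k, hk⟩ := exists_nat_gt (c - (μ (heightElement b)).re)
  induction k generalizing μ v with
  | zero =>
    refine absurd (eq_zero_of_mem_lowerPart b (c := c) ?_ hv (by rw [hc]; trivial)) hv0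
    simp at hk; linarith
  | succ k ih =>
    by_cases hs : ∀ x ∈ nilradical b, ⁅x, v⁆ = 0
    · exact ⟨μ, v, hvP, hv0, hv, hs⟩
    · have : ∃ α : H.root, b.IsPos α ∧
          ∃ x ∈ LieAlgebra.rootSpace H (α : LieModule.Weight ℂ H g), ⁅x, v⁆ ≠ 0 := by
        by_contra! hcon
        exact hs fun x hx ↦ nilradical_induction b (P := fun x ↦ ⁅x, v⁆ = 0) (by simp)
          (fun x y hx hy ↦ by rw [add_lie, hx, hy, add_zero]) hcon hx
      obtain ⟨α, hα, x, hx, hxv⟩ := this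
      refine ih _ _ (hP.nilradical x (mem_nilradical_of_mem_rootSpace b hα hx) v hvP) hxv
        (lie_mem_weightSpace hx hv) ?_
      have h2 : 1 ≤ ((α : LieModule.Weight ℂ H g) (heightElement b)).re := by
        rw [root_heightElement, Complex.intCast_re]
        exact_mod_cast hα
      simp only [LinearMap.add_apply, Complex.add_re, LieModule.Weight.toLinear_apply]
      push_cast at hk
      linarith

end LowerPart

/-! ### The Casimir operator and finiteness of its level sets on root lattice cosets -/

section Casimir

variable {g : Type*} [LieRing g] [LieAlgebra ℂ g] [FiniteDimensional ℂ g] [LieAlgebra.IsSemisimple ℂ g]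
  {H : LieSubalgebra ℂ g} [H.IsCartanSubalgebra]
  {M : Type*} [AddCommGroup M] [Module ℂ M] [LieRingModule g M] [LieModule ℂ g M]
  {ι : Type*} [Fintype ι] [DecidableEq ι]

/-- The basis dual to `e` with respect to the Killing form. -/
def killingDual (e : Basis ι ℂ g) : Basis ι ℂ g :=
  (killingForm ℂ g).dualBasis (LieAlgebra.IsKilling.killingForm_nondegenerate ℂ g) e

theorem killingForm_killingDual (e : Basis ι ℂ g) (i j : ι) :
    killingForm ℂ g (killingDual e i) (e j) = if j = i then 1 else 0 :=
  LinearMap.BilinForm.apply_dualBasis_left _ _ _ _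

theorem sum_killingForm_smul_killingDual (e : Basis ι ℂ g) (x : g) :
    ∑ i, killingForm ℂ g x (e i) • killingDual e i = x := by
  conv_rhs => rw [← (killingDual e).sum_repr x]
  exact Finset.sum_congr rfl fun i _ ↦ by
    rw [killingDual, LinearMap.BilinForm.dualBasis_repr_apply]

theorem sum_killingForm_killingDual_smul (e : Basis ι ℂ g) (x : g) :
    ∑ i, killingForm ℂ g x (killingDual e i) • e i = x := by
  have h : killingDual (killingDual e) = e :=
    LinearMap.BilinForm.dualBasis_dualBasis _ ⟨fun x y ↦ LieModule.traceForm_comm ℂ g g x y⟩ e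
  conv_rhs => rw [← sum_killingForm_smul_killingDual (killingDual e) x, h]

variable (M) in
/-- The action of the Casimir element. -/
def casimir (e : Basis ι ℂ g) : End ℂ M :=
  ∑ i, LieModule.toEnd ℂ g M (e i) * LieModule.toEnd ℂ g M (killingDual e i)

theorem casimir_apply (e : Basis ι ℂ g) (v : M) :
    casimir M e v = ∑ i, ⁅e i, ⁅killingDual e i, v⁆⁆ := by
  simp [casimir]

/-- By invariance of the Killing form, the matrix of `ad x` in the dual basis is minus the transpose
of its matrix in `e`, so the two commutator sums cancel. -/
theorem lie_casimir (e : Basis ι ℂ g) (x : g) (v : M) :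
    ⁅x, casimir M e v⁆ = casimir M e ⁅x, v⁆ := by
  have h1 : ∑ i, ⁅⁅x, e i⁆, ⁅killingDual e i, v⁆⁆ = ∑ i, ∑ j,
      killingForm ℂ g ⁅x, e i⁆ (killingDual e j) • ⁅e j, ⁅killingDual e i, v⁆⁆ := by
    refine Finset.sum_congr rfl fun i _ ↦ ?_
    conv_lhs => rw [← sum_killingForm_killingDual_smul e ⁅x, e i⁆]
    rw [sum_lie]
    simp only [smul_lie]
  have h2 : ∑ j, ⁅e j, ⁅⁅x, killingDual e j⁆, v⁆⁆ = ∑ i, ∑ j,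
      killingForm ℂ g ⁅x, killingDual e j⁆ (e i) • ⁅e j, ⁅killingDual e i, v⁆⁆ := by
    rw [Finset.sum_comm]
    refine Finset.sum_congr rfl fun j _ ↦ ?_
    conv_lhs => rw [← sum_killingForm_smul_killingDual e ⁅x, killingDual e j⁆]
    rw [sum_lie, lie_sum]
    simp only [smul_lie, lie_smul]
  have h3 : ∀ i j, killingForm ℂ g ⁅x, e i⁆ (killingDual e j) =
      - killingForm ℂ g ⁅x, killingDual e j⁆ (e i) := fun i j ↦ by
    rw [LieModule.traceForm_apply_lie_apply', LieModule.traceForm_comm]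
  have h4 : ∑ i, ⁅⁅x, e i⁆, ⁅killingDual e i, v⁆⁆ + ∑ j, ⁅e j, ⁅⁅x, killingDual e j⁆, v⁆⁆ = 0 := by
    rw [h1, h2]
    simp only [h3, neg_smul, Finset.sum_neg_distrib, neg_add_cancel]
  rw [casimir_apply, casimir_apply, lie_sum]
  rw [← zero_add (∑ i, ⁅e i, ⁅killingDual e i, ⁅x, v⁆⁆⁆), ← h4, ← Finset.sum_add_distrib,
    ← Finset.sum_add_distrib]
  refine Finset.sum_congr rfl fun i _ ↦ ?_
  rw [leibniz_lie x (e i), leibniz_lie x (killingDual e i), lie_add, add_assoc]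

theorem map_casimir {M' : Type*} [AddCommGroup M'] [Module ℂ M'] [LieRingModule g M']
    [LieModule ℂ g M'] (f : M →ₗ⁅ℂ, g⁆ M') (e : Basis ι ℂ g) (v : M) :
    f (casimir M e v) = casimir M' e (f v) := by
  simp [casimir_apply]

variable (H) in
theorem exists_rootBasis : ∃ (n : ℕ) (e : Basis (Fin n) ℂ g) (wt : Fin n → LieModule.Weight ℂ H g),
    ∀ i, e i ∈ LieAlgebra.rootSpace H (wt i) := by
  classical
  have hint : DirectSum.IsInternal fun χ : LieModule.Weight ℂ H g ↦
      (LieAlgebra.rootSpace H χ).toSubmodule := by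
    refine DirectSum.isInternal_submodule_of_iSupIndep_of_iSup_eq_top
      (LieSubmodule.iSupIndep_toSubmodule.2 (LieModule.iSupIndep_genWeightSpace' ℂ H g)) ?_
    rw [← LieSubmodule.iSup_toSubmodule, LieModule.iSup_genWeightSpace_eq_top' ℂ H g,
      LieSubmodule.top_toSubmodule]
  let e := hint.collectedBasis fun χ ↦ Module.finBasis ℂ (LieAlgebra.rootSpace H χ)
  let ε := Fintype.equivFin (Σ χ : LieModule.Weight ℂ H g,
    Fin (finrank ℂ (LieAlgebra.rootSpace H χ)))
  refine ⟨_, e.reindex ε, fun i ↦ (ε.symm i).1, fun i ↦ ?_⟩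
  rw [Basis.reindex_apply]
  exact hint.collectedBasis_mem _ _

variable {e : Basis ι ℂ g} {wt : ι → LieModule.Weight ℂ H g}

/-- Pairing with each `e j` and using invariance shows that the defect of the eigenvector equation
vanishes. -/
theorem killingDual_mem_rootSpace (he : ∀ i, e i ∈ LieAlgebra.rootSpace H (wt i)) (i : ι) :
    killingDual e i ∈ LieAlgebra.rootSpace H (-wt i) := by
  refine LieModule.weightSpace_le_genWeightSpace g _ ((LieModule.mem_weightSpace _ _).2 fun h ↦ ?_)
  change ⁅(h : g), killingDual e i⁆ = (-(wt i h)) • killingDual e i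
  rw [← sub_eq_zero, ← sum_killingForm_smul_killingDual e
    (⁅(h : g), killingDual e i⁆ - (-(wt i h)) • killingDual e i)]
  refine Finset.sum_eq_zero fun j _ ↦ ?_
  have h1 : ⁅(h : g), e j⁆ = wt j h • e j := LieAlgebra.IsKilling.lie_eq_smul_of_mem_rootSpace (he j) h
  rw [map_sub, LinearMap.sub_apply, LieModule.traceForm_apply_lie_apply', h1, map_smul, map_smul,
    LinearMap.smul_apply]
  erw [killingForm_killingDual]
  split_ifs with hij
  · subst hij; simp
  · simp

/-- The element of `𝔥` corresponding to `μ` under the Killing form. -/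
abbrev dualElement (μ : Dual ℂ H) : H := (LieAlgebra.IsKilling.cartanEquivDual H).symm μ

theorem killingForm_dualElement (μ : Dual ℂ H) (h : H) :
    killingForm ℂ g (dualElement μ : g) (h : g) = μ h := by
  have : LieAlgebra.IsKilling.cartanEquivDual H (dualElement μ) h = μ h := by
    rw [LinearEquiv.apply_symm_apply]
  exact this

theorem killingForm_cartan_eq_zero (h : H) {α : LieModule.Weight ℂ H g} (hα : α.IsNonZero) {x : g}
    (hx : x ∈ LieAlgebra.rootSpace H α) : killingForm ℂ g (h : g) x = 0 := by
  refine LieAlgebra.killingForm_apply_eq_zero_of_mem_rootSpace_of_add_ne_zero ℂ g H (α := 0) (β := α)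
    ?_ hx ?_
  · rw [LieAlgebra.rootSpace_zero_eq]; exact h.2
  · rw [zero_add]; exact hα

open Classical in
/-- The element of `𝔥` corresponding to the sum of the positive roots. -/
def twoRho (b : (LieAlgebra.IsKilling.rootSystem H).Base) (wt : ι → LieModule.Weight ℂ H g) : H :=
  ∑ i, if ∃ α : H.root, b.IsPos α ∧ (α : LieModule.Weight ℂ H g) = wt i then
    dualElement (wt i).toLinear else 0

/-- Three cases. A basis vector of weight zero acts with its dual by scalars. For a positive root,
`e i` kills `v`, leaving the bracket, which is the element of `𝔥` dual to the root. For a negative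
root the dual vector lies in `𝔫` and kills `v`. -/
theorem IsSingular.lie_lie_eq_smul {b : (LieAlgebra.IsKilling.rootSystem H).Base}
    (he : ∀ i, e i ∈ LieAlgebra.rootSpace H (wt i)) {μ : Dual ℂ H} {v : M}
    (hv : IsSingular b μ v) (i : ι) [Decidable (∃ α : H.root, b.IsPos α ∧
      (α : LieModule.Weight ℂ H g) = wt i)] :
    ⁅e i, ⁅killingDual e i, v⁆⁆ =
      (killingForm ℂ g (dualElement μ : g) (e i) *
        killingForm ℂ g (dualElement μ : g) (killingDual e i) +
        μ (if ∃ α : H.root, b.IsPos α ∧ (α : LieModule.Weight ℂ H g) = wt i then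
          dualElement (wt i).toLinear else 0)) • v := by
  have hd := killingDual_mem_rootSpace he i
  by_cases h0 : (wt i).IsZero
  · have hne : ¬ ∃ α : H.root, b.IsPos α ∧ (α : LieModule.Weight ℂ H g) = wt i := by
      rintro ⟨α, -, hα⟩
      exact H.isNonZero_coe_root α (hα ▸ h0)
    have h1 : e i ∈ H := by
      have := he i
      rwa [show ((wt i : LieModule.Weight ℂ H g) : H → ℂ) = 0 from h0,
        LieAlgebra.rootSpace_zero_eq] at this
    have h2 : killingDual e i ∈ H := by
      rwa [show ((wt i : LieModule.Weight ℂ H g) : H → ℂ) = 0 from h0, neg_zero,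
        LieAlgebra.rootSpace_zero_eq] at hd
    have h3 := mem_weightSpace_iff.1 hv.weight
    rw [if_neg hne, map_zero, add_zero, h3 ⟨_, h2⟩, lie_smul, h3 ⟨_, h1⟩, smul_smul,
      ← killingForm_dualElement μ ⟨_, h1⟩, ← killingForm_dualElement μ ⟨_, h2⟩, mul_comm]
  · rw [killingForm_cartan_eq_zero _ h0 (he i), zero_mul, zero_add]
    let α : H.root := ⟨wt i, by simpa using h0⟩
    by_cases hp : b.IsPos α
    · rw [if_pos ⟨α, hp, rfl⟩, leibniz_lie, hv.lie_eq_zero _ (mem_nilradical_of_mem_rootSpace b hp (he i)),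
        lie_zero, add_zero, LieAlgebra.IsKilling.lie_eq_killingForm_smul_of_mem_rootSpace_of_mem_rootSpace_neg (he i) hd,
        LieModule.traceForm_comm]
      have hk := killingForm_killingDual e i i
      rw [if_pos rfl] at hk
      erw [hk]
      rw [one_smul]
      exact mem_weightSpace_iff.1 hv.weight _
    · have hne : ¬ ∃ α : H.root, b.IsPos α ∧ (α : LieModule.Weight ℂ H g) = wt i := by
        rintro ⟨β, hβ, hα⟩
        exact hp (by rwa [show β = α from Subtype.ext hα] at hβ)
      rw [if_neg hne, map_zero, zero_smul]
      have hneg : b.IsPos ((LieAlgebra.IsKilling.rootSystem H).reflectionPerm α α) :=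
        (RootPairing.Base.IsPos.neg_iff_not b α).2 hp
      have hwt : ((((LieAlgebra.IsKilling.rootSystem H).reflectionPerm α α : H.root) :
          LieModule.Weight ℂ H g) : H → ℂ) = -wt i := by
        have := RootPairing.root_reflectionPerm (LieAlgebra.IsKilling.rootSystem H) α α
        rw [RootPairing.reflection_apply_self] at this
        ext h
        exact LinearMap.congr_fun this h
      rw [hv.lie_eq_zero _ (mem_nilradical_of_mem_rootSpace b hneg (by rwa [hwt])), lie_zero]

/-- The scalar by which the Casimir element acts on singular vectors of weight `μ`. -/
def casimirScalar (b : (LieAlgebra.IsKilling.rootSystem H).Base)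
    (wt : ι → LieModule.Weight ℂ H g) (μ : Dual ℂ H) : ℂ :=
  killingForm ℂ g (dualElement μ : g) (dualElement μ : g) + μ (twoRho b wt)

theorem IsSingular.casimir_eq_smul {b : (LieAlgebra.IsKilling.rootSystem H).Base}
    (he : ∀ i, e i ∈ LieAlgebra.rootSpace H (wt i)) {μ : Dual ℂ H} {v : M}
    (hv : IsSingular b μ v) : casimir M e v = casimirScalar b wt μ • v := by
  classical
  have h1 : killingForm ℂ g (dualElement μ : g) (dualElement μ : g) =
      ∑ i, killingForm ℂ g (dualElement μ : g) (e i) *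
        killingForm ℂ g (dualElement μ : g) (killingDual e i) := by
    conv_lhs => arg 2; rw [← sum_killingForm_smul_killingDual e (dualElement μ : g)]
    rw [map_sum]
    simp only [map_smul, smul_eq_mul]
  rw [casimir_apply, casimirScalar, h1, twoRho, map_sum, ← Finset.sum_add_distrib, Finset.sum_smul]
  exact Finset.sum_congr rfl fun i _ ↦ hv.lie_lie_eq_smul he i

/-- The root lattice. -/
def rootLattice (H : LieSubalgebra ℂ g) [H.IsCartanSubalgebra] : AddSubgroup (Dual ℂ H) :=
  AddSubgroup.closure (Set.range fun α : H.root ↦ (α : LieModule.Weight ℂ H g).toLinear)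

theorem killingForm_cartan (x y : H) :
    killingForm ℂ g (x : g) (y : g) =
      ∑ α : H.root, (α : LieModule.Weight ℂ H g) x * (α : LieModule.Weight ℂ H g) y := by
  have h := congr_arg (fun B ↦ B x y) (LieAlgebra.IsKilling.restrict_killingForm_eq_sum
    (K := ℂ) (L := g) (H := H))
  rw [← Finset.sum_coe_sort (s := H.root)] at h
  simp only [LinearMap.sum_apply, LinearMap.smulRight_apply, LinearMap.smul_apply,
    smul_eq_mul] at h
  exact h

theorem apply_eq_sum (μ : Dual ℂ H) (h : H) : μ h =
    ∑ α : H.root, (α : LieModule.Weight ℂ H g) (dualElement μ) * (α : LieModule.Weight ℂ H g) h := by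
  rw [← killingForm_dualElement, killingForm_cartan]

/-- Take `n` to be the Killing square of the coroot of `β`, an integer because it is the sum of the
squares of the integers `γ(β^∨)`. It equals `4 / (β, β)`, so `n (α, β) = 2 α(β^∨)`. -/
theorem exists_int_eq_apply_dualElement_root (β : H.root) : ∃ n : ℤ, n ≠ 0 ∧ ∀ α : H.root, ∃ k : ℤ,
    n * (α : LieModule.Weight ℂ H g) (dualElement (β : LieModule.Weight ℂ H g).toLinear) = k := by
  have hint : ∀ γ : H.root, ∃ k : ℤ,
      (γ : LieModule.Weight ℂ H g) (LieAlgebra.IsKilling.coroot (β : LieModule.Weight ℂ H g)) = k :=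
    fun γ ↦ ⟨_, LieAlgebra.IsKilling.apply_coroot_eq_cast _ _⟩
  choose k hk using hint
  have hβ := H.isNonZero_coe_root β
  have h0 : β.1 (dualElement β.1.toLinear) ≠ 0 :=
    LieAlgebra.IsKilling.root_apply_cartanEquivDual_symm_ne_zero hβ
  have h2 := LieAlgebra.IsKilling.root_apply_coroot hβ
  set β' : LieModule.Weight ℂ H g := β.1
  have h1 : ((∑ γ, k γ * k γ : ℤ) : ℂ) * β' (dualElement β'.toLinear) = 4 := by
    have h3 := killingForm_cartan (LieAlgebra.IsKilling.coroot β') (LieAlgebra.IsKilling.coroot β')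
    have h4 := LieAlgebra.IsKilling.traceForm_coroot β' (LieAlgebra.IsKilling.coroot β')
    rw [h2] at h4
    change killingForm ℂ g (LieAlgebra.IsKilling.coroot β' : g) _ = _ at h4
    rw [h4] at h3
    simp only [hk] at h3
    push_cast
    rw [← h3, dualElement]
    simp only [nsmul_eq_mul, smul_eq_mul, Nat.cast_ofNat]
    field_simp
    norm_num
  refine ⟨∑ γ, k γ * k γ, fun hz ↦ ?_, fun α ↦ ⟨2 * k α, ?_⟩⟩
  · rw [hz] at h1; norm_num at h1
  · have h5 : (α : LieModule.Weight ℂ H g) (LieAlgebra.IsKilling.coroot β') =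
        2 * (β' (dualElement β'.toLinear))⁻¹ *
          (α : LieModule.Weight ℂ H g) (dualElement β'.toLinear) := by
      rw [← LieModule.Weight.toLinear_apply, LieAlgebra.IsKilling.coroot, map_nsmul, map_smul]
      simp [mul_assoc]
    rw [hk] at h5
    push_cast at h1 ⊢
    rw [h5, ← mul_right_inj' h0]
    generalize ∑ x, (k x : ℂ) * (k x : ℂ) = s at h1 ⊢
    field_simp
    linear_combination ((α : LieModule.Weight ℂ H g) (dualElement β'.toLinear)) * h1

variable (H) in
theorem exists_denominator : ∃ D : ℤ, D ≠ 0 ∧ ∀ ν ∈ rootLattice H, ∀ α : H.root, ∃ k : ℤ,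
    D * (α : LieModule.Weight ℂ H g) (dualElement ν) = k := by
  choose n hn0 hn using exists_int_eq_apply_dualElement_root (H := H)
  refine ⟨∏ β, n β, Finset.prod_ne_zero_iff.2 fun β _ ↦ hn0 β, fun ν hν α ↦ ?_⟩
  induction hν using AddSubgroup.closure_induction with
  | mem x hx =>
    obtain ⟨β, rfl⟩ := hx
    obtain ⟨k, hk⟩ := hn β α
    obtain ⟨m, hm⟩ := Finset.dvd_prod_of_mem n (Finset.mem_univ β)
    refine ⟨m * k, ?_⟩
    rw [hm]; push_cast
    rw [← hk]; ring
  | zero => exact ⟨0, by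
    rw [← LieModule.Weight.toLinear_apply, dualElement, map_zero, map_zero]; simp⟩
  | add x y _ _ hx hy =>
    obtain ⟨k, hk⟩ := hx
    obtain ⟨l, hl⟩ := hy
    refine ⟨k + l, ?_⟩
    rw [← LieModule.Weight.toLinear_apply] at *
    rw [dualElement, map_add, map_add, mul_add, Int.cast_add, ← hk, ← hl]
  | neg x _ hx =>
    obtain ⟨k, hk⟩ := hx
    refine ⟨-k, ?_⟩
    rw [← LieModule.Weight.toLinear_apply] at *
    rw [dualElement, map_neg, map_neg, mul_neg, Int.cast_neg, ← hk]

/-- The coordinates `y i` are rational with denominator `D`. Completing the square in the real part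
of the equation bounds them, leaving finitely many numerators. -/
theorem finite_setOf_sum_sq_add_mul_eq {ι : Type*} [Fintype ι] (D : ℤ) (hD : D ≠ 0) (c : ι → ℂ)
    (a : ℂ) : {y : ι → ℂ | (∀ i, ∃ k : ℤ, D * y i = k) ∧ ∑ i, (y i ^ 2 + c i * y i) = a}.Finite := by
  classical
  let R : ℝ := a.re + ∑ i, ((c i).re / 2) ^ 2
  let B : ℝ := |(D : ℝ)| * (R + 1 + ∑ i, |(c i).re / 2|)
  obtain ⟨N, hN⟩ := exists_int_gt B
  refine ((Set.finite_Icc (fun _ : ι ↦ -N) fun _ ↦ N).image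
    fun (k : ι → ℤ) i ↦ (k i : ℂ) / D).subset ?_
  rintro y ⟨hk, hy⟩
  choose k hk using hk
  have hD' : (D : ℂ) ≠ 0 := Int.cast_ne_zero.2 hD
  have hDr : (D : ℝ) ≠ 0 := Int.cast_ne_zero.2 hD
  have hyk : ∀ i, y i = ((k i / D : ℝ) : ℂ) := fun i ↦ by
    push_cast
    rw [eq_div_iff hD', mul_comm]; exact hk i
  refine ⟨k, ?_, funext fun i ↦ by rw [hyk i]; push_cast; rfl⟩
  have hsum : ∑ i, ((k i / D : ℝ) + (c i).re / 2) ^ 2 = R := by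
    have h := congr_arg Complex.re hy
    rw [Complex.re_sum] at h
    simp only [R]
    rw [← h, ← Finset.sum_add_distrib]
    refine Finset.sum_congr rfl fun i _ ↦ ?_
    rw [hyk i, ← Complex.ofReal_pow, Complex.add_re, Complex.ofReal_re, Complex.re_mul_ofReal]
    ring
  have habs : ∀ i, |(k i : ℝ)| ≤ B := by
    intro i
    have h1 : ((k i / D : ℝ) + (c i).re / 2) ^ 2 ≤ R := by
      rw [← hsum]
      exact Finset.single_le_sum (f := fun i ↦ ((k i / D : ℝ) + (c i).re / 2) ^ 2)
        (fun i _ ↦ sq_nonneg _) (Finset.mem_univ i)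
    -- The crude bound `R + 1` replaces the square root of `R`.
    have h2 : |(k i / D : ℝ) + (c i).re / 2| ≤ R + 1 := by
      rw [abs_le]; constructor <;> nlinarith
    have h3 : |(c i).re / 2| ≤ ∑ i, |(c i).re / 2| :=
      Finset.single_le_sum (f := fun i ↦ |(c i).re / 2|) (fun i _ ↦ abs_nonneg _)
        (Finset.mem_univ i)
    have h4 : |(k i / D : ℝ)| ≤ R + 1 + ∑ i, |(c i).re / 2| := by
      have := abs_sub ((k i / D : ℝ) + (c i).re / 2) ((c i).re / 2)
      rw [add_sub_cancel_right] at this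
      linarith
    calc |(k i : ℝ)| = |(D : ℝ)| * |(k i / D : ℝ)| := by
          rw [← abs_mul, mul_div_cancel₀ _ hDr]
      _ ≤ B := mul_le_mul_of_nonneg_left h4 (abs_nonneg _)
  constructor
  · intro i
    have : -(N : ℝ) ≤ k i := by linarith [(abs_le.1 (habs i)).1]
    exact_mod_cast this
  · intro i
    have : (k i : ℝ) ≤ N := by linarith [(abs_le.1 (habs i)).2]
    exact_mod_cast this

/-- In the coordinates `α(dualElement ν)`, with `α` over all roots, the Killing form is a plain sum
of squares. These coordinates determine `ν` and have a common denominator on the root lattice. -/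
theorem finite_setOf_casimirScalar_eq (b : (LieAlgebra.IsKilling.rootSystem H).Base)
    (wt : ι → LieModule.Weight ℂ H g) (lam : Dual ℂ H) (a : ℂ) :
    {ν : Dual ℂ H | ν ∈ rootLattice H ∧ casimirScalar b wt (lam + ν) = a}.Finite := by
  obtain ⟨D, hD, hint⟩ := exists_denominator H
  let f : Dual ℂ H → H.root → ℂ := fun ν α ↦ (α : LieModule.Weight ℂ H g) (dualElement ν)
  have hf : Function.Injective f := by
    intro ν ν' h
    ext x
    rw [apply_eq_sum ν, apply_eq_sum ν']
    exact Finset.sum_congr rfl fun α _ ↦ congr_arg (· * _) (congr_fun h α)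
  have hadd : ∀ ν α, f (lam + ν) α = f lam α + f ν α := fun ν α ↦ by
    simp only [f, ← LieModule.Weight.toLinear_apply, dualElement, map_add]
  have hq : ∀ μ, casimirScalar b wt μ =
      ∑ α, (f μ α * f μ α + f μ α * (α : LieModule.Weight ℂ H g) (twoRho b wt)) := fun μ ↦ by
    rw [casimirScalar, killingForm_cartan, apply_eq_sum μ (twoRho b wt), ← Finset.sum_add_distrib]
  refine Set.Finite.of_finite_image ?_ (hf.injOn)
  refine (finite_setOf_sum_sq_add_mul_eq D hD
    (fun α ↦ 2 * f lam α + (α : LieModule.Weight ℂ H g) (twoRho b wt))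
    (a - casimirScalar b wt lam)).subset ?_
  rintro _ ⟨ν, ⟨hν, hνa⟩, rfl⟩
  refine ⟨hint ν hν, ?_⟩
  rw [← hνa, hq, hq, ← Finset.sum_sub_distrib]
  refine Finset.sum_congr rfl fun α _ ↦ ?_
  rw [hadd]
  ring

end Casimir

/-! ### Finiteness properties of modules in category `𝓞` -/

section CategoryO

variable {g : Type*} [LieRing g] [LieAlgebra ℂ g] [FiniteDimensional ℂ g] [LieAlgebra.IsSemisimple ℂ g]
  {H : LieSubalgebra ℂ g} [H.IsCartanSubalgebra]
  {b : (LieAlgebra.IsKilling.rootSystem H).Base}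
  {M : Type*} [AddCommGroup M] [Module ℂ M] [LieRingModule g M] [LieModule ℂ g M]

theorem IsBorelStable.sup {V W : Submodule ℂ M} (hV : IsBorelStable b V) (hW : IsBorelStable b W) :
    IsBorelStable b (V ⊔ W) := by
  constructor
  · intro h v hv
    obtain ⟨u, hu, w, hw, rfl⟩ := Submodule.mem_sup.1 hv
    rw [lie_add]
    exact Submodule.add_mem_sup (hV.cartan h u hu) (hW.cartan h w hw)
  · intro x hx v hv
    obtain ⟨u, hu, w, hw, rfl⟩ := Submodule.mem_sup.1 hv
    rw [lie_add]
    exact Submodule.add_mem_sup (hV.nilradical x hx u hu) (hW.nilradical x hx w hw)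

theorem isBorelStable_lieSpan_nilradical {μ : Dual ℂ H} {v : M}
    (hv : v ∈ LieModule.weightSpace M (μ : H → ℂ)) :
    IsBorelStable b (LieSubmodule.lieSpan ℂ (nilradical b) ({v} : Set M)).toSubmodule := by
  have hn : ∀ x ∈ nilradical b, ∀ u ∈ LieSubmodule.lieSpan ℂ (nilradical b) ({v} : Set M),
      ⁅x, u⁆ ∈ LieSubmodule.lieSpan ℂ (nilradical b) ({v} : Set M) :=
    fun x hx u hu ↦ LieSubmodule.lie_mem _ (x := (⟨x, hx⟩ : nilradical b)) hu
  refine ⟨fun h u hu ↦ ?_, hn⟩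
  refine LieSubmodule.lieSpan_induction ℂ (nilradical b)
    (p := fun u _ ↦ ⁅(h : g), u⁆ ∈ LieSubmodule.lieSpan ℂ (nilradical b) ({v} : Set M))
    ?_ (by simp) ?_ ?_ ?_ hu
  · rintro u rfl
    rw [mem_weightSpace_iff.1 hv]
    exact SMulMemClass.smul_mem _ (LieSubmodule.subset_lieSpan rfl)
  · intro x y _ _ hx hy
    rw [lie_add]; exact add_mem hx hy
  · intro a x _ hx
    rw [lie_smul]; exact SMulMemClass.smul_mem _ hx
  · intro x y hy hxy
    change ⁅(h : g), ⁅(x : g), y⁆⁆ ∈ _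
    rw [leibniz_lie]
    exact add_mem (hn _ (lie_cartan_mem_nilradical b h x.2) _ hy) (hn _ x.2 _ hxy)

theorem CategoryO.weightSum_univ (hM : CategoryO b M) : weightSum H M Set.univ = ⊤ := by
  have h := congr_arg LieSubmodule.toSubmodule hM.hSemisimple
  rw [LieSubmodule.iSup_toSubmodule, LieSubmodule.top_toSubmodule] at h
  simpa [weightSum] using h

theorem CategoryO.exists_isBorelStable_mem (hM : CategoryO b M) (v : M) :
    ∃ V : Submodule ℂ M, V.FG ∧ IsBorelStable b V ∧ v ∈ V := by
  refine weightSum_induction (H := H) (Λ := Set.univ)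
    (P := fun v ↦ ∃ V : Submodule ℂ M, V.FG ∧ IsBorelStable b V ∧ v ∈ V) ?_ ?_ ?_
    (show v ∈ weightSum H M Set.univ by rw [hM.weightSum_univ]; trivial)
  · exact ⟨⊥, Submodule.fg_bot, ⟨by simp, by simp⟩, zero_mem _⟩
  · rintro u w ⟨V, hV, hVb, hu⟩ ⟨W, hW, hWb, hw⟩
    exact ⟨V ⊔ W, hV.sup hW, hVb.sup hWb, Submodule.add_mem_sup hu hw⟩
  · intro μ _ u hu
    exact ⟨_, Module.Finite.iff_fg.1 (hM.locallyFinite u), isBorelStable_lieSpan_nilradical hu,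
      LieSubmodule.subset_lieSpan rfl⟩

theorem exists_finite_le_weightSum (hM : weightSum H M Set.univ = ⊤) {V : Submodule ℂ M}
    (hV : V.FG) : ∃ Λ : Set (Dual ℂ H), Λ.Finite ∧ V ≤ weightSum H M Λ := by
  have sup : ∀ V W : Submodule ℂ M, (∃ Λ : Set (Dual ℂ H), Λ.Finite ∧ V ≤ weightSum H M Λ) →
      (∃ Λ : Set (Dual ℂ H), Λ.Finite ∧ W ≤ weightSum H M Λ) →
      ∃ Λ : Set (Dual ℂ H), Λ.Finite ∧ V ⊔ W ≤ weightSum H M Λ := by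
    rintro V W ⟨Λ, hΛ, hV⟩ ⟨Λ', hΛ', hW⟩
    exact ⟨Λ ∪ Λ', hΛ.union hΛ', sup_le (hV.trans (weightSum_mono Set.subset_union_left))
      (hW.trans (weightSum_mono Set.subset_union_right))⟩
  refine Submodule.fg_induction
    (motive := fun V _ ↦ ∃ Λ : Set (Dual ℂ H), Λ.Finite ∧ V ≤ weightSum H M Λ) (fun v ↦ ?_)
    (fun V W hV hW h1 h2 ↦ sup V W h1 h2) V hV
  refine weightSum_induction (H := H) (Λ := Set.univ)
    (P := fun v ↦ ∃ Λ : Set (Dual ℂ H), Λ.Finite ∧ (ℂ ∙ v) ≤ weightSum H M Λ) ?_ ?_ ?_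
    (show v ∈ weightSum H M Set.univ by rw [hM]; trivial)
  · exact ⟨∅, Set.finite_empty, by simp⟩
  · intro u w hu hw
    obtain ⟨Λ, hΛ, hle⟩ := sup _ _ hu hw
    refine ⟨Λ, hΛ, le_trans ?_ hle⟩
    rw [Submodule.span_singleton_le_iff_mem]
    exact Submodule.add_mem_sup (Submodule.mem_span_singleton_self u)
      (Submodule.mem_span_singleton_self w)
  · intro μ _ u hu
    exact ⟨{μ}, Set.finite_singleton μ, (Submodule.span_singleton_le_iff_mem _ _).2
      (weightSpace_le_weightSum (Set.mem_singleton μ) hu)⟩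

variable (b) in
theorem exists_weightSum_le_lowerPart {Λ : Set (Dual ℂ H)} (hΛ : Λ.Finite) :
    ∃ c : ℝ, weightSum H M Λ ≤ lowerPart M b c := by
  obtain ⟨c, hc⟩ := (hΛ.image fun μ ↦ (μ (heightElement b)).re).bddAbove
  exact ⟨c, weightSum_mono fun μ hμ ↦ hc ⟨μ, hμ, rfl⟩⟩

/-- Each generator is a sum of weight vectors `u`, and each `U(𝔫)u` is finite-dimensional and
`𝔥`-stable; the sum of these spaces is `V`. -/
theorem CategoryO.exists_generating (hM : CategoryO b M) :
    ∃ (V : Submodule ℂ M) (Λ : Set (Dual ℂ H)), V.FG ∧ IsBorelStable b V ∧ Λ.Finite ∧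
      V ≤ weightSum H M Λ ∧ LieSubmodule.lieSpan ℂ g (V : Set M) = ⊤ := by
  obtain ⟨s, hs⟩ := hM.finitelyGenerated
  have h : ∃ V : Submodule ℂ M, V.FG ∧ IsBorelStable b V ∧ (s : Set M) ⊆ V := by
    classical
    clear hs
    induction s using Finset.induction_on with
    | empty => exact ⟨⊥, Submodule.fg_bot, ⟨by simp, by simp⟩, by simp⟩
    | insert v s _ ih =>
      obtain ⟨V, hV, hVb, hsV⟩ := ih
      obtain ⟨W, hW, hWb, hvW⟩ := hM.exists_isBorelStable_mem v
      refine ⟨V ⊔ W, hV.sup hW, hVb.sup hWb, ?_⟩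
      rw [Finset.coe_insert, Set.insert_subset_iff]
      exact ⟨Submodule.mem_sup_right hvW, fun x hx ↦ Submodule.mem_sup_left (hsV hx)⟩
  obtain ⟨V, hV, hVb, hsV⟩ := h
  obtain ⟨Λ, hΛ, hle⟩ := exists_finite_le_weightSum hM.weightSum_univ hV
  exact ⟨V, Λ, hV, hVb, hΛ, hle, eq_top_iff.2 (hs ▸ LieSubmodule.lieSpan_mono hsV)⟩

theorem CategoryO.exists_lowerPart_eq_top (hM : CategoryO b M) : ∃ c : ℝ, lowerPart M b c = ⊤ := by
  obtain ⟨V, Λ, -, hVb, hΛ, hle, htop⟩ := hM.exists_generating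
  obtain ⟨c, hc⟩ := exists_weightSum_le_lowerPart (M := M) b hΛ
  refine ⟨c, eq_top_iff.2 ?_⟩
  have := lieSpan_le_lowerPart hVb (hle.trans hc)
  rwa [htop, LieSubmodule.top_toSubmodule] at this

theorem CategoryO.finiteDimensional_quotient_lowerPart (hM : CategoryO b M) (c : ℝ) :
    FiniteDimensional ℂ (M ⧸ lowerPart M b c) := by
  obtain ⟨V, Λ, hV, hVb, hΛ, hle, htop⟩ := hM.exists_generating
  obtain ⟨C, hC⟩ := exists_weightSum_le_lowerPart (M := M) b hΛ
  -- With `C - j < c`, everything outside the finite-dimensional `j`-th iterate falls below height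
  -- `c`.
  obtain ⟨j, hj⟩ := exists_nat_gt (C - c)
  have h := lieSpan_le_lowerIterate_sup_lowerPart hVb (hle.trans hC) j
  rw [htop, LieSubmodule.top_toSubmodule] at h
  have hW := fg_lowerIterate b hV j
  rw [FiniteDimensional, Module.finite_def]
  have : (lowerIterate b V j).map (lowerPart M b c).mkQ = ⊤ := by
    rw [eq_top_iff]
    intro x _
    obtain ⟨v, rfl⟩ := Submodule.mkQ_surjective _ x
    obtain ⟨u, hu, w, hw, rfl⟩ := Submodule.mem_sup.1 (h (show v ∈ ⊤ from trivial))
    refine ⟨u, hu, ?_⟩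
    rw [map_add, left_eq_add, Submodule.mkQ_apply, Submodule.Quotient.mk_eq_zero]
    exact lowerPart_mono b (by linarith) hw
  rw [← this]
  exact hW.map _

/-- The weight space injects into the quotient by the part at least one below the height of `μ`. -/
theorem CategoryO.finiteDimensional_weightSpace (hM : CategoryO b M) (μ : Dual ℂ H) :
    FiniteDimensional ℂ (LieModule.weightSpace M (μ : H → ℂ)).toSubmodule := by
  have := hM.finiteDimensional_quotient_lowerPart ((μ (heightElement b)).re - 1)
  refine Module.Finite.of_injective ((lowerPart M b ((μ (heightElement b)).re - 1)).mkQ ∘ₗ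
    (LieModule.weightSpace M (μ : H → ℂ)).toSubmodule.subtype) ?_
  rw [← LinearMap.ker_eq_bot, LinearMap.ker_eq_bot']
  intro v hv
  ext
  refine eq_zero_of_mem_lowerPart b (c := (μ (heightElement b)).re - 1) (by linarith) v.2 ?_
  simpa using hv

theorem weightSum_lattice_eq_top (b : (LieAlgebra.IsKilling.rootSystem H).Base) {V : Submodule ℂ M} {Λ : Set (Dual ℂ H)}
    (hV : V ≤ weightSum H M Λ) (htop : LieSubmodule.lieSpan ℂ g (V : Set M) = ⊤) :
    weightSum H M {μ | ∃ lam ∈ Λ, μ - lam ∈ rootLattice H} = ⊤ := by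
  set Λ' : Set (Dual ℂ H) := {μ | ∃ lam ∈ Λ, μ - lam ∈ rootLattice H}
  have hroot : ∀ α : LieModule.Weight ℂ H g, ∀ x ∈ LieAlgebra.rootSpace H α,
      ∀ v ∈ weightSum H M Λ', ⁅x, v⁆ ∈ weightSum H M Λ' := by
    intro α x hx v hv
    refine weightSum_induction (P := fun v ↦ ⁅x, v⁆ ∈ weightSum H M Λ') (by simp)
      (fun x y hx hy ↦ by rw [lie_add]; exact add_mem hx hy) (fun μ hμ v hv ↦ ?_) hv
    refine weightSpace_le_weightSum ?_ (lie_mem_weightSpace hx hv)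
    obtain ⟨lam, hlam, hμ⟩ := hμ
    refine ⟨lam, hlam, ?_⟩
    rw [add_sub_right_comm]
    refine add_mem hμ ?_
    by_cases h0 : α.IsZero
    · have : α.toLinear = 0 := by
        ext h; exact congr_fun h0 h
      rw [this]; exact zero_mem _
    · exact AddSubgroup.subset_closure ⟨⟨α, by simpa using h0⟩, rfl⟩
  let N : LieSubmodule ℂ g M :=
    { weightSum H M Λ' with
      lie_mem := by
        intro x v hv
        refine induction_on_roots b (P := fun x ↦ ⁅x, v⁆ ∈ weightSum H M Λ')
          (fun x y hx hy ↦ by rw [add_lie]; exact add_mem hx hy)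
          (fun x hx ↦ ?_) (fun h ↦ lie_cartan_mem_weightSum h hv) (fun x hx ↦ ?_) x
        · exact negPart_induction b (P := fun x ↦ ⁅x, v⁆ ∈ weightSum H M Λ') (by simp)
            (fun x y hx hy ↦ by rw [add_lie]; exact add_mem hx hy)
            (fun α _ x hx ↦ hroot _ x hx v hv) hx
        · exact nilradical_induction b (P := fun x ↦ ⁅x, v⁆ ∈ weightSum H M Λ') (by simp)
            (fun x y hx hy ↦ by rw [add_lie]; exact add_mem hx hy)
            (fun α _ x hx ↦ hroot _ x hx v hv) hx }
  have hN : N = ⊤ := by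
    rw [eq_top_iff, ← htop, LieSubmodule.lieSpan_le]
    exact fun v hv ↦ weightSum_mono (show Λ ⊆ Λ' from fun μ hμ ↦ ⟨μ, hμ, by simp⟩) (hV hv)
  exact congr_arg LieSubmodule.toSubmodule hN

theorem map_aeval_apply {V W : Type*} [AddCommGroup V] [Module ℂ V] [AddCommGroup W] [Module ℂ W]
    (φ : V →ₗ[ℂ] W) {f : End ℂ V} {f' : End ℂ W} (h : ∀ v, φ (f v) = f' (φ v)) (p : Polynomial ℂ)
    (v : V) : φ (Polynomial.aeval f p v) = Polynomial.aeval f' p (φ v) := by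
  have hpow : ∀ n : ℕ, ∀ v, φ ((f ^ n) v) = (f' ^ n) (φ v) := fun n ↦ by
    induction n with
    | zero => simp
    | succ n ih => intro v; rw [pow_succ, pow_succ, Module.End.mul_apply, ih, h]; rfl
  induction p using Polynomial.induction_on' with
  | add p q hp hq => simp [hp, hq]
  | monomial n a => simp [Polynomial.aeval_monomial, hpow]

/-- The Casimir preserves a finite-dimensional sum of weight spaces that generates `M`. Its minimal
polynomial there gives an operator commuting with `𝔤` and killing generators, hence zero. -/
theorem CategoryO.exists_polynomial_casimir (hM : CategoryO b M) {ι : Type*} [Fintype ι]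
    [DecidableEq ι] (e : Basis ι ℂ g) :
    ∃ p : Polynomial ℂ, p ≠ 0 ∧ Polynomial.aeval (casimir M e) p = 0 := by
  obtain ⟨V, Λ, -, -, hΛ, hle, htop⟩ := hM.exists_generating
  have hfd : FiniteDimensional ℂ (weightSum H M Λ) := by
    have : Finite Λ := hΛ
    have := fun μ : Dual ℂ H ↦ hM.finiteDimensional_weightSpace μ
    rw [weightSum, iSup_subtype']
    infer_instance
  have hstab : ∀ v ∈ weightSum H M Λ, casimir M e v ∈ weightSum H M Λ := by
    intro v hv
    exact map_mem_weightSum (f := casimir M e) (fun h v ↦ (lie_casimir e _ v).symm) hv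
  let f := (casimir M e).restrict hstab
  refine ⟨minpoly ℂ f, minpoly.ne_zero (Algebra.IsIntegral.isIntegral f), ?_⟩
  have hcomm : ∀ (p : Polynomial ℂ) (x : g) (v : M),
      ⁅x, Polynomial.aeval (casimir M e) p v⁆ = Polynomial.aeval (casimir M e) p ⁅x, v⁆ := by
    intro p x
    exact fun v ↦ map_aeval_apply (LieModule.toEnd ℂ g M x) (fun v ↦ lie_casimir e x v) p v
  let N : LieSubmodule ℂ g M :=
    { LinearMap.ker (Polynomial.aeval (casimir M e) (minpoly ℂ f)) with
      lie_mem := by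
        intro x v hv
        change Polynomial.aeval (casimir M e) (minpoly ℂ f) ⁅x, v⁆ = 0
        rw [← hcomm, show Polynomial.aeval (casimir M e) (minpoly ℂ f) v = 0 from hv, lie_zero] }
  have hres : ∀ (p : Polynomial ℂ) (v : weightSum H M Λ),
      Polynomial.aeval (casimir M e) p (v : M) = (Polynomial.aeval f p v : weightSum H M Λ) :=
    fun p v ↦ (map_aeval_apply (weightSum H M Λ).subtype (f := f) (fun v ↦ rfl) p v).symm
  have hN : N = ⊤ := by
    rw [eq_top_iff, ← htop, LieSubmodule.lieSpan_le]
    intro v hv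
    change Polynomial.aeval (casimir M e) (minpoly ℂ f) v = 0
    rw [hres _ ⟨v, hle hv⟩, minpoly.aeval]; rfl
  ext v
  exact (show v ∈ N by rw [hN]; trivial)

/-- The set `S` is uniform in `N`: the annihilating polynomial and the lattice cosets of `M` serve
every quotient. A singular weight then lies in one of these cosets, and its Casimir scalar is a root
of the polynomial. -/
theorem CategoryO.finite_singular_weights (hM : CategoryO b M) :
    ∃ S : Set (Dual ℂ H), S.Finite ∧ ∀ (N : LieSubmodule ℂ g M) (μ : Dual ℂ H) (v : M ⧸ N),
      v ≠ 0 → IsSingular b μ v → μ ∈ S := by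
  obtain ⟨V, Λ, -, -, hΛ, hle, htop⟩ := hM.exists_generating
  obtain ⟨n, e, wt, he⟩ := exists_rootBasis H
  obtain ⟨p, hp0, hp⟩ := hM.exists_polynomial_casimir e
  refine ⟨⋃ lam ∈ Λ, ⋃ a ∈ {a | p.IsRoot a}, (fun ν ↦ lam + ν) ''
    {ν : Dual ℂ H | ν ∈ rootLattice H ∧ casimirScalar b wt (lam + ν) = a},
    hΛ.biUnion fun lam _ ↦ (Polynomial.finite_setOfPred_isRoot hp0).biUnion fun a _ ↦
      (finite_setOf_casimirScalar_eq b wt lam a).image _, fun N μ v hv hs ↦ ?_⟩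
  have hμ : μ ∈ {μ | ∃ lam ∈ Λ, μ - lam ∈ rootLattice H} := by
    by_contra hμ
    refine hv (eq_zero_of_mem_weightSum hμ hs.weight ?_)
    rw [weightSum_eq_top_of_surjective (LieSubmodule.Quotient.surjective_mk' N)
      (weightSum_lattice_eq_top b hle htop)]
    trivial
  obtain ⟨lam, hlam, hν⟩ := hμ
  have hroot : p.IsRoot (casimirScalar b wt μ) := by
    obtain ⟨u, rfl⟩ := LieSubmodule.Quotient.surjective_mk' N v
    have h1 := map_aeval_apply (LieSubmodule.Quotient.mk' N : M →ₗ[ℂ] M ⧸ N) (f := casimir M e)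
      (f' := casimir (M ⧸ N) e) (fun v ↦ map_casimir _ e v) p u
    rw [hp, LinearMap.zero_apply, map_zero] at h1
    have h2 : Module.End.HasEigenvector (casimir (M ⧸ N) e) (casimirScalar b wt μ)
        (LieSubmodule.Quotient.mk' N u) :=
      ⟨Module.End.mem_eigenspace_iff.2 (hs.casimir_eq_smul he), hv⟩
    have h3 := Module.End.aeval_apply_of_hasEigenvector (p := p) h2
    exact (smul_eq_zero.1 (h3.symm.trans h1.symm)).resolve_right hv
  simp only [Set.mem_iUnion]
  exact ⟨lam, hlam, _, hroot, μ - lam, ⟨hν, by simp⟩, by simp⟩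

theorem CategoryO.lowerPart_quotient (hM : CategoryO b M) : ∃ c : ℝ, ∀ N : LieSubmodule ℂ g M,
    lowerPart (M ⧸ N) b c = ⊤ := by
  obtain ⟨c, hc⟩ := hM.exists_lowerPart_eq_top
  exact ⟨c, fun N ↦ weightSum_eq_top_of_surjective (LieSubmodule.Quotient.surjective_mk' N) hc⟩

theorem isBorelStable_lieSubmodule (b : (LieAlgebra.IsKilling.rootSystem H).Base)
    (N : LieSubmodule ℂ g M) : IsBorelStable b N.toSubmodule :=
  ⟨fun h _ hv ↦ N.lie_mem (x := (h : g)) hv, fun _ _ _ hv ↦ N.lie_mem hv⟩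

/-- Modules in category `𝓞` are Noetherian. -/
theorem CategoryO.wellFoundedGT (hM : CategoryO b M) : WellFoundedGT (LieSubmodule ℂ g M) := by
  obtain ⟨S, hS, hSsing⟩ := hM.finite_singular_weights
  obtain ⟨C, hC⟩ := hM.lowerPart_quotient
  -- All singular vectors of all quotients have height at least `c`, so cutting at `c - 1` loses
  -- none of them.
  obtain ⟨c, hc⟩ := (hS.image fun μ ↦ (μ (heightElement b)).re).bddBelow
  have hfd := hM.finiteDimensional_quotient_lowerPart (c - 1)
  let F : LieSubmodule ℂ g M → Submodule ℂ (M ⧸ lowerPart M b (c - 1)) := fun N ↦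
    N.toSubmodule.map (lowerPart M b (c - 1)).mkQ
  have hF : StrictMono F := by
    intro N N' hlt
    refine lt_of_le_of_ne (Submodule.map_mono hlt.le) fun heq ↦ ?_
    let q := LieSubmodule.Quotient.mk' N
    have hne : (N'.map q).toSubmodule ≠ ⊥ := by
      rw [Ne, LieSubmodule.toSubmodule_eq_bot, LieSubmodule.Quotient.map_mk'_eq_bot_le]
      exact hlt.not_ge
    obtain ⟨μ, v, hvN, hv0, hv⟩ := exists_isSingular_mem (b := b)
      (weightSum_eq_top_of_surjective (LieSubmodule.Quotient.surjective_mk' N) hM.weightSum_univ)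
      (hC N) (isBorelStable_lieSubmodule b (N'.map q)) hne
    -- If `N` and `N'` had the same image, a lift of `v` would agree modulo `N` with an element of
    -- the lower part, against the height of `v`.
    refine hv0 (eq_zero_of_mem_lowerPart b (c := c - 1) ?_ hv.weight ?_)
    · have := hc ⟨μ, hSsing N μ v hv0 hv, rfl⟩
      simp only at this
      linarith
    · obtain ⟨u, hu, rfl⟩ := (LieSubmodule.mem_map _).1 hvN
      have h1 : (lowerPart M b (c - 1)).mkQ u ∈ F N := by
        rw [heq]; exact Submodule.mem_map_of_mem hu
      obtain ⟨w, hw, hwu⟩ := h1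
      have h2 : u - w ∈ lowerPart M b (c - 1) := by
        rw [← Submodule.ker_mkQ (lowerPart M b (c - 1)), LinearMap.mem_ker, map_sub, hwu, sub_self]
      have h3 : q u = q (u - w) := by
        rw [map_sub, (LieSubmodule.Quotient.mk_eq_zero N).2 hw, sub_zero]
      rw [h3]
      exact map_mem_weightSum (f := (q : M →ₗ[ℂ] M ⧸ N)) (fun h v ↦ q.map_lie _ _) h2
  exact hF.wellFoundedGT

end CategoryO

/-! ### Universal property of Verma modules and recognition of `L(μ)` -/

section Verma

attribute [local instance] LieRing.ofAssociativeRing LieAlgebra.ofAssociativeAlgebra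

variable {g : Type*} [LieRing g] [LieAlgebra ℂ g] [FiniteDimensional ℂ g] [LieAlgebra.IsSemisimple ℂ g]
  {H : LieSubalgebra ℂ g} [H.IsCartanSubalgebra]
  (b : (LieAlgebra.IsKilling.rootSystem H).Base) (μ : Dual ℂ H)
  {M : Type*} [AddCommGroup M] [Module ℂ M] [LieRingModule g M] [LieModule ℂ g M]

/-- The universal property gives a map from `U(𝔤)` to `S` whose composite with the inclusion is the
identity on `𝔤`, hence on `U(𝔤)`. -/
theorem universalEnveloping_subalgebra_eq_top
    (S : Subalgebra ℂ (UniversalEnvelopingAlgebra ℂ g))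
    (hS : ∀ x : g, UniversalEnvelopingAlgebra.ι ℂ x ∈ S) : S = ⊤ := by
  let f : g →ₗ⁅ℂ⁆ S :=
    { toFun := fun x ↦ ⟨UniversalEnvelopingAlgebra.ι ℂ x, hS x⟩
      map_add' := fun x y ↦ Subtype.ext (map_add _ x y)
      map_smul' := fun c x ↦ Subtype.ext (map_smul _ c x)
      map_lie' := fun {x y} ↦ Subtype.ext (LieHom.map_lie _ x y) }
  have h : S.val.comp (UniversalEnvelopingAlgebra.lift ℂ f) = AlgHom.id ℂ _ := by
    ext x
    change ((UniversalEnvelopingAlgebra.lift ℂ f (UniversalEnvelopingAlgebra.ι ℂ x) : S) :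
      UniversalEnvelopingAlgebra ℂ g) = UniversalEnvelopingAlgebra.ι ℂ x
    rw [UniversalEnvelopingAlgebra.lift_ι_apply]; rfl
  rw [eq_top_iff]
  intro u _
  rw [← AlgHom.id_apply (R := ℂ) u, ← h]
  exact (UniversalEnvelopingAlgebra.lift ℂ f u).2

/-- The class of an element of `U(𝔤)` in the Verma module. -/
def Verma.mk : UniversalEnvelopingAlgebra ℂ g →ₗ[UniversalEnvelopingAlgebra ℂ g] Verma b μ :=
  (vermaIdeal b μ).mkQ

/-- The highest weight vector of the Verma module. -/
def Verma.vector : Verma b μ := Verma.mk b μ 1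

theorem Verma.lie_mk (x : g) (u : UniversalEnvelopingAlgebra ℂ g) :
    ⁅x, Verma.mk b μ u⁆ = Verma.mk b μ (UniversalEnvelopingAlgebra.ι ℂ x * u) :=
  ((Verma.mk b μ).map_smul (UniversalEnvelopingAlgebra.ι ℂ x) u).symm

theorem Verma.mk_smul (c : ℂ) (u : UniversalEnvelopingAlgebra ℂ g) :
    Verma.mk b μ (c • u) = c • Verma.mk b μ u :=
  LinearMap.map_smul_of_tower (Verma.mk b μ) c u

theorem Verma.mk_eq_zero {u : UniversalEnvelopingAlgebra ℂ g} :
    Verma.mk b μ u = 0 ↔ u ∈ vermaIdeal b μ :=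
  Submodule.Quotient.mk_eq_zero _

theorem Verma.isSingular_vector : IsSingular b μ (Verma.vector b μ) := by
  constructor
  · refine mem_weightSpace_iff.2 fun h ↦ ?_
    rw [Verma.vector, Verma.lie_mk, mul_one, ← sub_eq_zero, ← Verma.mk_smul, ← map_sub,
      Verma.mk_eq_zero, ← Algebra.algebraMap_eq_smul_one]
    exact Submodule.subset_span (Or.inr ⟨h, rfl⟩)
  · intro x hx
    rw [Verma.vector, Verma.lie_mk, mul_one, Verma.mk_eq_zero]
    exact Submodule.subset_span (Or.inl ⟨x, hx, rfl⟩)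

theorem Verma.lieSpan_vector : LieSubmodule.lieSpan ℂ g {Verma.vector b μ} = ⊤ := by
  set N := LieSubmodule.lieSpan ℂ g {Verma.vector b μ}
  let S : Subalgebra ℂ (UniversalEnvelopingAlgebra ℂ g) :=
    { carrier := {u | ∀ v ∈ N, u • v ∈ N}
      mul_mem' := fun {u u'} hu hu' v hv ↦ by rw [mul_smul]; exact hu _ (hu' v hv)
      add_mem' := fun {u u'} hu hu' v hv ↦ by rw [add_smul]; exact add_mem (hu v hv) (hu' v hv)
      algebraMap_mem' := fun c v hv ↦ by
        rw [algebraMap_smul]; exact SMulMemClass.smul_mem c hv }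
  have hS := universalEnveloping_subalgebra_eq_top S fun x v hv ↦ N.lie_mem (x := x) hv
  rw [eq_top_iff]
  intro v _
  obtain ⟨u, rfl⟩ := Submodule.mkQ_surjective _ v
  have h1 : u ∈ S := by rw [hS]; trivial
  have h2 : u • Verma.vector b μ ∈ N := h1 _ (LieSubmodule.subset_lieSpan rfl)
  have h3 : u • Verma.vector b μ = Verma.mk b μ u := by
    rw [Verma.vector, ← map_smul, smul_eq_mul, mul_one]
  rw [h3] at h2
  exact h2

variable {b μ}

/-- The homomorphism from the Verma module determined by a singular vector. -/
theorem IsSingular.exists_verma_hom {w : M} (hw : IsSingular b μ w) :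
    ∃ φ : Verma b μ →ₗ⁅ℂ, g⁆ M, φ (Verma.vector b μ) = w := by
  let ρ : UniversalEnvelopingAlgebra ℂ g →ₐ[ℂ] End ℂ M :=
    UniversalEnvelopingAlgebra.lift ℂ (LieModule.toEnd ℂ g M)
  have hρ : ∀ (x : g) (v : M), ρ (UniversalEnvelopingAlgebra.ι ℂ x) v = ⁅x, v⁆ := fun x v ↦ by
    simp only [ρ]
    rw [UniversalEnvelopingAlgebra.lift_ι_apply]; rfl
  let I : Submodule (UniversalEnvelopingAlgebra ℂ g) (UniversalEnvelopingAlgebra ℂ g) :=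
    { carrier := {u | ρ u w = 0}
      add_mem' := fun {u u'} hu hu' ↦ by
        change ρ (u + u') w = 0
        rw [map_add, LinearMap.add_apply, show ρ u w = 0 from hu, show ρ u' w = 0 from hu',
          add_zero]
      zero_mem' := by simp
      smul_mem' := fun a u hu ↦ by
        change ρ (a * u) w = 0
        rw [map_mul, Module.End.mul_apply, show ρ u w = 0 from hu, map_zero] }
  have hI : vermaIdeal b μ ≤ I := by
    rw [vermaIdeal, Submodule.span_le]
    rintro u (⟨x, hx, rfl⟩ | ⟨h, rfl⟩)
    · change ρ _ w = 0
      rw [hρ, hw.lie_eq_zero x hx]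
    · change ρ _ w = 0
      rw [map_sub, LinearMap.sub_apply, hρ, mem_weightSpace_iff.1 hw.weight, AlgHom.commutes,
        Module.algebraMap_end_apply, sub_self]
  let Φ : UniversalEnvelopingAlgebra ℂ g →ₗ[ℂ] M := (LinearMap.applyₗ w) ∘ₗ ρ.toLinearMap
  have hΦ : (vermaIdeal b μ).restrictScalars ℂ ≤ LinearMap.ker Φ := fun u hu ↦ hI hu
  let φ : Verma b μ →ₗ[ℂ] M := (Submodule.liftQ _ Φ hΦ) ∘ₗ
    (Submodule.Quotient.restrictScalarsEquiv ℂ (vermaIdeal b μ)).symm.toLinearMap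
  have hφ : ∀ u, φ (Verma.mk b μ u) = ρ u w := fun u ↦ rfl
  refine ⟨{ φ with map_lie' := fun {x v} ↦ ?_ }, ?_⟩
  · obtain ⟨u, rfl⟩ : ∃ u, Verma.mk b μ u = v := Submodule.mkQ_surjective _ v
    change φ _ = ⁅x, φ _⁆
    rw [Verma.lie_mk, hφ, hφ, map_mul, Module.End.mul_apply, hρ]
  · change φ (Verma.mk b μ 1) = w
    rw [hφ, map_one]; rfl

/-- Each proper submodule avoids the weight `μ`, hence so does their sum; this is why the radical is
itself proper. -/
theorem vermaRadical_le_lowerPart :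
    (vermaRadical b μ).toSubmodule ≤
      lowerPart (Verma b μ) b ((μ (heightElement b)).re - 1) := by
  rw [vermaRadical, LieSubmodule.sSup_toSubmodule, sSup_le_iff]
  rintro _ ⟨N, hN, rfl⟩
  refine (Verma.isSingular_vector b μ).le_lowerPart ?_
  rw [Verma.lieSpan_vector]
  exact lt_top_iff_ne_top.2 hN

/-- A simple module generated by a singular vector of weight `μ` is isomorphic to `L(μ)`. -/
theorem IsSingular.exists_simpleHW_hom {w : M} (hw : IsSingular b μ w) (hw0 : w ≠ 0)
    (hatom : IsAtom (LieSubmodule.lieSpan ℂ g {w})) :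
    ∃ θ : SimpleHW b μ →ₗ⁅ℂ, g⁆ M, Function.Injective θ ∧
      θ.range = LieSubmodule.lieSpan ℂ g {w} := by
  obtain ⟨φ, hφ⟩ := hw.exists_verma_hom
  have hv0 : Verma.vector b μ ≠ 0 := fun h ↦ hw0 (by rw [← hφ, h, map_zero])
  have hrad : Verma.vector b μ ∉ vermaRadical b μ := fun h ↦
    hv0 (eq_zero_of_mem_lowerPart b (c := (μ (heightElement b)).re - 1) (by linarith)
      (Verma.isSingular_vector b μ).weight (vermaRadical_le_lowerPart h))
  have hrange : φ.range = LieSubmodule.lieSpan ℂ g {w} := by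
    rw [← LieModuleHom.map_top, ← Verma.lieSpan_vector]
    refine le_antisymm ?_ ?_
    · rw [LieSubmodule.map_le_iff_le_comap, LieSubmodule.lieSpan_le, Set.singleton_subset_iff]
      change φ _ ∈ LieSubmodule.lieSpan ℂ g {w}
      rw [hφ]
      exact LieSubmodule.subset_lieSpan rfl
    · rw [LieSubmodule.lieSpan_le, Set.singleton_subset_iff]
      exact (LieSubmodule.mem_map _).2 ⟨_, LieSubmodule.subset_lieSpan rfl, hφ⟩
  have hker : φ.ker ≤ vermaRadical b μ := le_sSup fun h ↦ hw0 (by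
    rw [← hφ, ← LieModuleHom.mem_ker, h]; trivial)
  -- The radical maps to zero or onto the simple module. In the second case `w = φ r` with `r` in
  -- the radical, and since `ker φ` lies in the radical, the highest weight vector would too.
  have hle : vermaRadical b μ ≤ φ.ker := by
    rcases hatom.le_iff.1 (show (vermaRadical b μ).map φ ≤ LieSubmodule.lieSpan ℂ g {w} by
      rw [← hrange, ← LieModuleHom.map_top]; exact LieSubmodule.map_mono le_top) with h | h
    · intro v hv
      rw [LieModuleHom.mem_ker, ← LieSubmodule.mem_bot (R := ℂ) (L := g), ← h]
      exact LieSubmodule.mem_map_of_mem hv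
    · exfalso
      have : w ∈ (vermaRadical b μ).map φ := by
        rw [h]; exact LieSubmodule.subset_lieSpan rfl
      obtain ⟨r, hr, hrw⟩ := (LieSubmodule.mem_map _).1 this
      have h1 : Verma.vector b μ - r ∈ vermaRadical b μ :=
        hker (by rw [LieModuleHom.mem_ker, map_sub, hrw, hφ, sub_self])
      exact hrad (by simpa using add_mem h1 hr)
  let θ : SimpleHW b μ →ₗ[ℂ] M :=
    Submodule.liftQ (vermaRadical b μ).toSubmodule (φ : Verma b μ →ₗ[ℂ] M) fun v hv ↦ hle hv
  have hθ : ∀ v, θ (LieSubmodule.Quotient.mk' _ v) = φ v := fun v ↦ rfl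
  have hθlie : ∀ (x : g) (v : SimpleHW b μ), θ ⁅x, v⁆ = ⁅x, θ v⁆ := by
    intro x v
    obtain ⟨v, rfl⟩ := LieSubmodule.Quotient.surjective_mk' _ v
    rw [← LieModuleHom.map_lie, hθ, hθ, LieModuleHom.map_lie]
  refine ⟨{ θ with map_lie' := fun {x v} ↦ hθlie x v }, ?_, ?_⟩
  · change Function.Injective θ
    rw [← LinearMap.ker_eq_bot, LinearMap.ker_eq_bot']
    intro v hv
    obtain ⟨v, rfl⟩ := LieSubmodule.Quotient.surjective_mk' _ v
    rw [hθ] at hv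
    exact (LieSubmodule.Quotient.mk_eq_zero _).2 (hker hv)
  · rw [← hrange]
    ext y
    simp only [LieModuleHom.mem_range]
    constructor
    · rintro ⟨v, rfl⟩
      obtain ⟨v, rfl⟩ := LieSubmodule.Quotient.surjective_mk' _ v
      exact ⟨v, rfl⟩
    · rintro ⟨v, rfl⟩
      exact ⟨LieSubmodule.Quotient.mk' _ v, rfl⟩

end Verma

/-! ### Identifying a subquotient through a common target -/

section Subquotient

variable {k : Type*} [LieRing k] [LieAlgebra ℂ k]
  {M Q B : Type*} [AddCommGroup M] [Module ℂ M] [LieRingModule k M] [LieModule ℂ k M]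
  [AddCommGroup Q] [Module ℂ Q] [LieRingModule k Q] [LieModule ℂ k Q]
  [AddCommGroup B] [Module ℂ B] [LieRingModule k B] [LieModule ℂ k B]

/-- Both `A'/A` and `B` embed in `Q` with the same image. It serves over `𝔤` for `N'/N` and over `𝔭`
for the induced subquotient of a summand. -/
theorem nonempty_subquotient_equiv {A A' : LieSubmodule ℂ k M} (q : M →ₗ⁅ℂ, k⁆ Q)
    (f : B →ₗ⁅ℂ, k⁆ Q) (hf : Function.Injective f) (hker : ∀ v ∈ A', q v = 0 ↔ v ∈ A)
    (hrange : ∀ y, (∃ v ∈ A', q v = y) ↔ ∃ x, f x = y) :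
    Nonempty (Subquotient A A' ≃ₗ⁅ℂ, k⁆ B) := by
  let fe := LinearEquiv.ofInjective (f : B →ₗ[ℂ] Q) hf
  have hmem : ∀ v : A', q v ∈ LinearMap.range (f : B →ₗ[ℂ] Q) := fun v ↦
    (hrange _).1 ⟨v, v.2, rfl⟩
  let ψ : A' →ₗ[ℂ] B := fe.symm.toLinearMap ∘ₗ
    LinearMap.codRestrict _ ((q : M →ₗ[ℂ] Q) ∘ₗ A'.toSubmodule.subtype) hmem
  have hψ : ∀ v : A', f (ψ v) = q v := fun v ↦
    congr_arg Subtype.val (fe.apply_symm_apply ⟨q v, hmem v⟩)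
  have hψker : ∀ v : A', ψ v = 0 ↔ (v : M) ∈ A := fun v ↦ by
    rw [← hker v v.2, ← hψ, map_eq_zero_iff f hf]
  let e : Subquotient A A' →ₗ[ℂ] B :=
    Submodule.liftQ (A.comap A'.incl).toSubmodule ψ fun v hv ↦ (hψker v).2 hv
  have he : ∀ v, e (LieSubmodule.Quotient.mk' _ v) = ψ v := fun v ↦ rfl
  have hbij : Function.Bijective e := by
    constructor
    · rw [← LinearMap.ker_eq_bot, LinearMap.ker_eq_bot']
      intro v hv
      obtain ⟨v, rfl⟩ := LieSubmodule.Quotient.surjective_mk' _ v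
      exact (LieSubmodule.Quotient.mk_eq_zero _).2 ((hψker v).1 hv)
    · intro x
      obtain ⟨v, hv, hvx⟩ := (hrange (f x)).2 ⟨x, rfl⟩
      refine ⟨LieSubmodule.Quotient.mk' _ ⟨v, hv⟩, hf ?_⟩
      rw [he, hψ, hvx]
  refine ⟨{ LinearEquiv.ofBijective e hbij with map_lie' := fun {x v} ↦ ?_ }⟩
  obtain ⟨v, rfl⟩ := LieSubmodule.Quotient.surjective_mk' _ v
  change e ⁅x, LieSubmodule.Quotient.mk' _ v⁆ = ⁅x, e (LieSubmodule.Quotient.mk' _ v)⁆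
  rw [← LieModuleHom.map_lie, he, he]
  apply hf
  rw [hψ, LieModuleHom.map_lie, hψ, ← LieModuleHom.map_lie]
  rfl

end Subquotient

/-! ### The extension step: a simple module inside one summand -/

section Step

variable {g : Type*} [LieRing g] [LieAlgebra ℂ g] [FiniteDimensional ℂ g] [LieAlgebra.IsSemisimple ℂ g]
  {H : LieSubalgebra ℂ g} [H.IsCartanSubalgebra]
  {b : (LieAlgebra.IsKilling.rootSystem H).Base}
  {M : Type*} [AddCommGroup M] [Module ℂ M] [LieRingModule g M] [LieModule ℂ g M]

/-- A linear map that commutes with the action of `𝔟`. -/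
structure IsBorelLinear (b : (LieAlgebra.IsKilling.rootSystem H).Base) (f : End ℂ M) : Prop where
  cartan : ∀ (h : H) (v : M), f ⁅(h : g), v⁆ = ⁅(h : g), f v⁆
  nilradical : ∀ x ∈ CatO.nilradical b, ∀ v : M, f ⁅x, v⁆ = ⁅x, f v⁆

theorem IsBorelLinear.isSingular {f : End ℂ M} (hf : IsBorelLinear b f) {μ : Dual ℂ H} {v : M}
    (hv : IsSingular b μ v) : IsSingular b μ (f v) := by
  refine ⟨mem_weightSpace_iff.2 fun h ↦ ?_, fun x hx ↦ ?_⟩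
  · rw [← hf.cartan, mem_weightSpace_iff.1 hv.weight, map_smul]
  · rw [← hf.nilradical x hx, hv.lie_eq_zero x hx, map_zero]

theorem IsBorelLinear.sub_one {f : End ℂ M} (hf : IsBorelLinear b f) : IsBorelLinear b (f - 1) :=
  ⟨fun h v ↦ by simp [hf.cartan], fun x hx v ↦ by simp [hf.nilradical x hx]⟩

theorem IsBorelLinear.isBorelStable_map {f : End ℂ M} (hf : IsBorelLinear b f)
    {V : Submodule ℂ M} (hV : IsBorelStable b V) : IsBorelStable b (V.map f) := by
  constructor
  · rintro h _ ⟨v, hv, rfl⟩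
    exact ⟨_, hV.cartan h v hv, hf.cartan h v⟩
  · rintro x hx _ ⟨v, hv, rfl⟩
    exact ⟨_, hV.nilradical x hx v hv, hf.nilradical x hx v⟩

/-- If `w` is singular of weight `μ` and no weight of a singular vector is lower than `μ`, then
`w` generates a simple module, and a `𝔟`-linear map that fixes `w` fixes this module. -/
theorem IsSingular.isAtom_and_eqOn (hM : weightSum H M Set.univ = ⊤) {c : ℝ}
    (hc : lowerPart M b c = ⊤) {μ : Dual ℂ H} {w : M} (hw : IsSingular b μ w) (hw0 : w ≠ 0)
    (hmin : ∀ (μ' : Dual ℂ H) (v : M), v ≠ 0 → IsSingular b μ' v →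
      (μ (heightElement b)).re ≤ (μ' (heightElement b)).re) :
    IsAtom (LieSubmodule.lieSpan ℂ g {w}) ∧ ∀ f : End ℂ M, IsBorelLinear b f → f w = w →
      ∀ v ∈ LieSubmodule.lieSpan ℂ g {w}, f v = v := by
  -- Such a `P`, if nonzero, would contain a singular vector of height below that of `μ`.
  have key : ∀ P : Submodule ℂ M, IsBorelStable b P →
      P ≤ lowerPart M b ((μ (heightElement b)).re - 1) → P = ⊥ := by
    intro P hP hle
    by_contra hne
    obtain ⟨μ', v, hvP, hv0, hv⟩ := exists_isSingular_mem hM hc hP hne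
    refine hv0 (eq_zero_of_mem_lowerPart b ?_ hv.weight (hle hvP))
    linarith [hmin μ' v hv0 hv]
  refine ⟨⟨fun h ↦ hw0 ?_, fun N hN ↦ ?_⟩, fun f hf hfw v hv ↦ ?_⟩
  · exact (LieSubmodule.lieSpan_eq_bot_iff ℂ g M).1 h w rfl
  · exact (LieSubmodule.toSubmodule_eq_bot _).1
      (key _ (isBorelStable_lieSubmodule b N) (hw.le_lowerPart hN))
  -- `f - 1` preserves weights and kills `w`, so it sends `ℂw + lower` into the lower part, and its
  -- image is `𝔟`-stable.
  · have h0 := key _ (hf.sub_one.isBorelStable_map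
      (isBorelStable_lieSubmodule b (LieSubmodule.lieSpan ℂ g {w}))) ?_
    · have : (f - 1) v ∈ (⊥ : Submodule ℂ M) := by
        rw [← h0]; exact Submodule.mem_map_of_mem hv
      exact sub_eq_zero.1 ((Submodule.mem_bot ℂ).1 this)
    · rintro _ ⟨v, hv, rfl⟩
      obtain ⟨u, hu, t, ht, rfl⟩ := Submodule.mem_sup.1 (hw.lieSpan_le hv)
      obtain ⟨a, rfl⟩ := Submodule.mem_span_singleton.1 hu
      have : (f - 1) (a • w) = 0 := by simp [hfw]
      rw [map_add, this, zero_add]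
      exact map_mem_weightSum hf.sub_one.cartan ht

/-- A proper submodule that is stable under the projections of a decomposition of `Res M` extends,
inside a single summand, by a simple module. -/
theorem CategoryO.exists_step (hM : CategoryO b M) {ι : Type*} [Fintype ι] {π : ι → End ℂ M}
    (hπ : ∀ j, IsBorelLinear b (π j)) (hsum : ∀ v, ∑ j, π j v = v)
    (horth : ∀ i j, i ≠ j → ∀ v, π i (π j v) = 0) {N : LieSubmodule ℂ g M}
    (hN : ∀ j, ∀ v ∈ N, π j v ∈ N) (htop : N ≠ ⊤) :
    ∃ (k : ι) (N' : LieSubmodule ℂ g M) (μ : Dual ℂ H) (θ : SimpleHW b μ →ₗ⁅ℂ, g⁆ M ⧸ N),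
      N ⋖ N' ∧ (∀ v ∈ N', π k v - v ∈ N) ∧ Function.Injective θ ∧
        N' = θ.range.comap (LieSubmodule.Quotient.mk' N) := by
  classical
  let q := LieSubmodule.Quotient.mk' N
  have hq : Function.Surjective q := LieSubmodule.Quotient.surjective_mk' N
  have hq0 : ∀ v, q v = 0 ↔ v ∈ N := fun v ↦ LieSubmodule.Quotient.mk_eq_zero N
  have hidem : ∀ k v, π k (π k v) = π k v := fun k v ↦ by
    conv_rhs => rw [← hsum (π k v)]
    rw [Finset.sum_eq_single k (fun j _ hj ↦ horth j k hj v) (by simp)]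
  obtain ⟨S, hS, hSsing⟩ := hM.finite_singular_weights
  obtain ⟨C, hC⟩ := hM.lowerPart_quotient
  have hQ := weightSum_eq_top_of_surjective hq hM.weightSum_univ
  let T : Set (Dual ℂ H) := {μ | ∃ v : M ⧸ N, v ≠ 0 ∧ IsSingular b μ v}
  have hT : T.Finite := hS.subset fun μ ⟨v, hv0, hv⟩ ↦ hSsing N μ v hv0 hv
  have hTne : T.Nonempty := by
    obtain ⟨μ, v, -, hv0, hv⟩ := exists_isSingular_mem (b := b) (P := ⊤) hQ (hC N)
      ⟨fun _ _ _ ↦ trivial, fun _ _ _ _ ↦ trivial⟩ (by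
        intro h
        refine htop (eq_top_iff.2 fun v _ ↦ (hq0 v).1 ?_)
        have : q v ∈ (⊤ : Submodule ℂ (M ⧸ N)) := trivial
        rwa [h, Submodule.mem_bot] at this)
    exact ⟨μ, v, hv0, hv⟩
  obtain ⟨μ, ⟨v, hv0, hv⟩, hmin⟩ := Set.exists_min_image T (fun μ ↦ (μ (heightElement b)).re) hT hTne
  let πq : ι → End ℂ (M ⧸ N) := fun j ↦
    Submodule.mapQ N.toSubmodule N.toSubmodule (π j) fun v hv ↦ hN j v hv
  have hπq : ∀ j v, πq j (q v) = q (π j v) := fun j v ↦ rfl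
  have hπqB : ∀ j, IsBorelLinear b (πq j) := by
    refine fun j ↦ ⟨fun h u ↦ ?_, fun x hx u ↦ ?_⟩
    · obtain ⟨u, rfl⟩ := hq u
      rw [← LieModuleHom.map_lie, hπq, (hπ j).cartan, LieModuleHom.map_lie, hπq]
    · obtain ⟨u, rfl⟩ := hq u
      rw [← LieModuleHom.map_lie, hπq, (hπ j).nilradical x hx, LieModuleHom.map_lie, hπq]
  -- The components of `v` sum to `v`, so one survives; replacing `v` by it keeps the minimal weight
  -- `μ` and makes it fixed by `πq k`.
  obtain ⟨k, hk⟩ : ∃ k, πq k v ≠ 0 := by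
    by_contra! hcon
    obtain ⟨u, rfl⟩ := hq v
    apply hv0
    rw [← hsum u, map_sum]
    exact Finset.sum_eq_zero fun j _ ↦ hcon j
  have hwk : πq k (πq k v) = πq k v := by
    obtain ⟨u, rfl⟩ := hq v
    rw [hπq, hπq, hidem]
  obtain ⟨hatom, hfix⟩ := ((hπqB k).isSingular hv).isAtom_and_eqOn hQ (hC N) hk
    fun μ' u hu0 hu ↦ hmin μ' ⟨u, hu0, hu⟩
  obtain ⟨θ, hθ, hθr⟩ := ((hπqB k).isSingular hv).exists_simpleHW_hom hk hatom
  refine ⟨k, _, μ, θ, ?_, fun u hu ↦ ?_, hθ, rfl⟩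
  · rw [hθr]
    set L := LieSubmodule.lieSpan ℂ g {πq k v}
    have hmem : ∀ u, u ∈ L.comap q ↔ q u ∈ L := fun u ↦ Iff.rfl
    have hle : N ≤ L.comap q := fun u hu ↦ by
      rw [hmem, (hq0 u).2 hu]; exact zero_mem _
    refine ⟨lt_of_le_of_ne hle fun h ↦ hatom.1 ?_, fun X hNX hXL ↦ ?_⟩
    · rw [eq_bot_iff]
      intro y hy
      obtain ⟨u, rfl⟩ := hq y
      rw [LieSubmodule.mem_bot, hq0, h]
      exact hy
    · have hmap : X.map q ≤ L := by
        rw [LieSubmodule.map_le_iff_le_comap]; exact hXL.le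
      rcases hatom.le_iff.1 hmap with h | h
      · exact hNX.not_ge ((LieSubmodule.Quotient.map_mk'_eq_bot_le N X).1 h)
      · refine hXL.not_ge fun u hu ↦ ?_
        have : q u ∈ X.map q := by rw [h]; exact hu
        obtain ⟨x, hx, hxu⟩ := (LieSubmodule.mem_map _).1 this
        have hd : u - x ∈ N := by rw [← hq0, map_sub, hxu, sub_self]
        simpa using add_mem (hNX.le hd) hx
  · rw [← hq0, map_sub, ← hπq, sub_eq_zero]
    refine hfix _ (hπqB k) hwk _ ?_
    rw [← hθr]; exact hu

end Step

/-! ### Restriction to `𝔭` and projections onto summands -/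

section Restriction

variable {g : Type*} [LieRing g] [LieAlgebra ℂ g]
  {M : Type*} [AddCommGroup M] [Module ℂ M] [LieRingModule g M] [LieModule ℂ g M]
  {p : LieSubalgebra ℂ g}

/-- A homomorphism of `𝔤`-modules, viewed as a homomorphism of `𝔭`-modules. -/
def resHom {M' : Type*} [AddCommGroup M'] [Module ℂ M'] [LieRingModule g M'] [LieModule ℂ g M']
    (p : LieSubalgebra ℂ g) (f : M →ₗ⁅ℂ, g⁆ M') : M →ₗ⁅ℂ, p⁆ M' :=
  { (f : M →ₗ[ℂ] M') with map_lie' := fun {x m} ↦ f.map_lie (x : g) m }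

/-- The projections of an internal direct sum. -/
theorem exists_projections {k : Type*} [LieRing k] [LieAlgebra ℂ k] [LieRingModule k M]
    [LieModule ℂ k M] {ι : Type*} [Fintype ι] {A : ι → LieSubmodule ℂ k M}
    (hA : IsInternalSum ⊤ A) :
    ∃ π : ι → End ℂ M, (∀ j v, π j v ∈ A j) ∧ (∀ j, ∀ v ∈ A j, π j v = v) ∧
      (∀ i j, i ≠ j → ∀ v ∈ A j, π i v = 0) ∧ (∀ v, ∑ j, π j v = v) ∧
      ∀ j (x : k) v, π j ⁅x, v⁆ = ⁅x, π j v⁆ := by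
  classical
  let C : ι → LieSubmodule ℂ k M := fun j ↦ ⨆ (i) (_ : i ≠ j), A i
  have hle : ∀ i j, i ≠ j → A j ≤ C i := fun i j hij ↦
    le_iSup₂_of_le (f := fun (l : ι) (_ : l ≠ i) ↦ A l) j hij.symm le_rfl
  have hcompl : ∀ j, IsCompl (A j).toSubmodule (C j).toSubmodule := by
    intro j
    rw [LieSubmodule.isCompl_toSubmodule]
    refine ⟨hA.1 j, codisjoint_iff_le_sup.2 ?_⟩
    rw [← hA.2]
    refine iSup_le fun i ↦ ?_
    by_cases hij : i = j
    · subst hij; exact le_sup_left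
    · exact le_sup_of_le_right (hle j i (Ne.symm hij))
  let π : ι → End ℂ M := fun j ↦ (A j).toSubmodule.projection (C j).toSubmodule (hcompl j)
  have h1 : ∀ j, ∀ v ∈ A j, π j v = v := fun j v hv ↦
    Submodule.projection_apply_left (hcompl j) ⟨v, hv⟩
  have h2 : ∀ j, ∀ v ∈ C j, π j v = 0 := fun j v hv ↦
    Submodule.projection_apply_right (hcompl j) ⟨v, hv⟩
  have h3 : ∀ i j, i ≠ j → ∀ v ∈ A j, π i v = 0 := fun i j hij v hv ↦ h2 i v (hle i j hij hv)
  refine ⟨π, fun j v ↦ Submodule.projection_apply_mem (hcompl j) v, h1, h3, fun v ↦ ?_,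
    fun j x v ↦ ?_⟩
  · have hv : v ∈ ⨆ j, (A j).toSubmodule := by
      rw [← LieSubmodule.iSup_toSubmodule, hA.2]; trivial
    refine Submodule.iSup_induction _ (motive := fun v ↦ ∑ j, π j v = v) hv (fun i v hv ↦ ?_)
      (by simp) (fun u v hu hv ↦ by simp [Finset.sum_add_distrib, hu, hv])
    rw [Finset.sum_eq_single i (fun j _ hj ↦ h3 j i hj v hv) (by simp), h1 i v hv]
  · have hv : v ∈ (A j).toSubmodule ⊔ (C j).toSubmodule := by
      rw [(hcompl j).sup_eq_top]; trivial
    obtain ⟨a, ha, c, hc, rfl⟩ := Submodule.mem_sup.1 hv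
    rw [lie_add, map_add, map_add, h1 j a ha, h2 j c hc, add_zero,
      h1 j _ ((A j).lie_mem ha), h2 j _ ((C j).lie_mem hc), add_zero]

end Restriction

/-! ### Assembling the composition series and the filtrations of the summands -/

section Chain

variable {g : Type*} [LieRing g] [LieAlgebra ℂ g] [FiniteDimensional ℂ g] [LieAlgebra.IsSemisimple ℂ g]
  {H : LieSubalgebra ℂ g} [H.IsCartanSubalgebra]
  {b : (LieAlgebra.IsKilling.rootSystem H).Base} {p : LieSubalgebra ℂ g}
  {M : Type*} [AddCommGroup M] [Module ℂ M] [LieRingModule g M] [LieModule ℂ g M]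
  {ι : Type*}

/-- `N'` covers `N`, the two differ only in the summand `A k`, and the quotient is some `L(μ)`. -/
structure IsSummandStep (b : (LieAlgebra.IsKilling.rootSystem H).Base)
    (A : ι → LieSubmodule ℂ p M) (N N' : LieSubmodule ℂ g M) (k : ι) : Prop where
  covBy : N ⋖ N'
  inf_eq : ∀ j, j ≠ k → resSubmodule p N' ⊓ A j = resSubmodule p N ⊓ A j
  inf_lt : resSubmodule p N ⊓ A k < resSubmodule p N' ⊓ A k
  subquotient : ∃ μ : Dual ℂ H, Nonempty (Subquotient N N' ≃ₗ⁅ℂ, g⁆ SimpleHW b μ) ∧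
    Nonempty (Subquotient (resSubmodule p N ⊓ A k) (resSubmodule p N' ⊓ A k) ≃ₗ⁅ℂ, p⁆
      SimpleHW b μ)

theorem iSup_resSubmodule_inf [Fintype ι] {A : ι → LieSubmodule ℂ p M} {π : ι → End ℂ M}
    (hmem : ∀ j v, π j v ∈ A j) (hsum : ∀ v, ∑ j, π j v = v) {N : LieSubmodule ℂ g M}
    (hN : ∀ j, ∀ v ∈ N, π j v ∈ N) : ⨆ j, resSubmodule p N ⊓ A j = resSubmodule p N := by
  refine le_antisymm (iSup_le fun j ↦ inf_le_left) fun v hv ↦ ?_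
  rw [← hsum v]
  exact sum_mem fun j _ ↦ le_iSup (fun j ↦ resSubmodule p N ⊓ A j) j
    ((LieSubmodule.mem_inf _ _ _).2 ⟨hN j v hv, hmem j v⟩)

theorem CategoryO.exists_isSummandStep (hM : CategoryO b M) (hp : borel b ≤ p) [Fintype ι]
    {A : ι → LieSubmodule ℂ p M} {π : ι → End ℂ M}
    (hmem : ∀ j v, π j v ∈ A j) (hfix : ∀ j, ∀ v ∈ A j, π j v = v)
    (horth : ∀ i j, i ≠ j → ∀ v ∈ A j, π i v = 0) (hsum : ∀ v, ∑ j, π j v = v)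
    (hlie : ∀ j (x : p) v, π j ⁅x, v⁆ = ⁅x, π j v⁆) {N : LieSubmodule ℂ g M}
    (hN : ∀ j, ∀ v ∈ N, π j v ∈ N) (htop : N ≠ ⊤) :
    ∃ (k : ι) (N' : LieSubmodule ℂ g M), IsSummandStep b A N N' k ∧
      ∀ j, ∀ v ∈ N', π j v ∈ N' := by
  have hπ : ∀ j, IsBorelLinear b (π j) := fun j ↦
    ⟨fun h v ↦ hlie j ⟨h, hp (le_sup_left (a := H) h.2)⟩ v,
      fun x hx v ↦ hlie j ⟨x, hp (le_sup_right (a := H) hx)⟩ v⟩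
  have horth' : ∀ i j, i ≠ j → ∀ v, π i (π j v) = 0 := fun i j hij v ↦
    horth i j hij _ (hmem j v)
  obtain ⟨k, N', μ, θ, hcov, hk, hθ, hN'⟩ := hM.exists_step hπ hsum horth' hN htop
  have hN'mem : ∀ v, v ∈ N' ↔ ∃ x, θ x = LieSubmodule.Quotient.mk' N v := fun v ↦ by
    rw [hN', LieSubmodule.mem_comap, LieModuleHom.mem_range]
  have hmk : ∀ v, LieSubmodule.Quotient.mk' N v = 0 ↔ v ∈ N := fun v ↦
    LieSubmodule.Quotient.mk_eq_zero N
  -- Apply `π j` to `π k v - v ∈ N`; the first term dies by orthogonality.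
  have hother : ∀ j, j ≠ k → ∀ v ∈ N', π j v ∈ N := fun j hj v hv ↦ by
    have := hN j _ (hk v hv)
    rw [map_sub, horth' j k hj, zero_sub] at this
    simpa using this
  have hkN' : ∀ v ∈ N', π k v ∈ N' := fun v hv ↦ by
    simpa using add_mem (hcov.le (hk v hv)) hv
  have hmkk : ∀ v ∈ N', LieSubmodule.Quotient.mk' N (π k v) = LieSubmodule.Quotient.mk' N v :=
    fun v hv ↦ by rw [← sub_eq_zero, ← map_sub, hmk]; exact hk v hv
  refine ⟨k, N', ⟨hcov, fun j hj ↦ ?_, ?_, μ, ?_, ?_⟩, fun j v hv ↦ ?_⟩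
  · refine le_antisymm (fun v hv ↦ ?_) (inf_le_inf_right _ fun v hv ↦ hcov.le hv)
    obtain ⟨hv1, hv2⟩ := (LieSubmodule.mem_inf _ _ _).1 hv
    refine (LieSubmodule.mem_inf _ _ _).2 ⟨?_, hv2⟩
    rw [← hfix j v hv2]
    exact hother j hj v hv1
  · refine lt_of_le_of_ne (inf_le_inf_right _ fun v hv ↦ hcov.le hv) fun h ↦ ?_
    refine hcov.lt.not_ge fun v hv ↦ ?_
    have h1 : π k v ∈ resSubmodule p N ⊓ A k := by
      rw [h]; exact (LieSubmodule.mem_inf _ _ _).2 ⟨hkN' v hv, hmem k v⟩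
    have h2 : π k v ∈ N := ((LieSubmodule.mem_inf _ _ _).1 h1).1
    simpa using sub_mem h2 (hk v hv)
  · refine nonempty_subquotient_equiv (LieSubmodule.Quotient.mk' N) θ hθ (fun v _ ↦ hmk v)
      fun y ↦ ⟨?_, ?_⟩
    · rintro ⟨v, hv, rfl⟩
      exact (hN'mem v).1 hv
    · rintro ⟨x, rfl⟩
      obtain ⟨v, hv⟩ := LieSubmodule.Quotient.surjective_mk' N (θ x)
      exact ⟨v, (hN'mem v).2 ⟨x, hv.symm⟩, hv⟩
  -- The same `θ` works over `𝔭`: a class of `N'/N` represented by `v` is also represented by `π k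
  -- v`, which lies in `A k`.
  · refine nonempty_subquotient_equiv (resHom p (LieSubmodule.Quotient.mk' N)) (resHom p θ) hθ
      (fun v hv ↦ ?_) fun y ↦ ⟨?_, ?_⟩
    · refine (hmk v).trans ⟨fun h ↦ ?_, fun h ↦ ?_⟩
      · exact (LieSubmodule.mem_inf _ _ _).2 ⟨h, ((LieSubmodule.mem_inf _ _ _).1 hv).2⟩
      · exact ((LieSubmodule.mem_inf _ _ _).1 h).1
    · rintro ⟨v, hv, rfl⟩
      exact (hN'mem v).1 ((LieSubmodule.mem_inf _ _ _).1 hv).1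
    · rintro ⟨x, rfl⟩
      obtain ⟨v, hv⟩ := LieSubmodule.Quotient.surjective_mk' N (θ x)
      have hvN' : v ∈ N' := (hN'mem v).2 ⟨x, hv.symm⟩
      exact ⟨π k v, (LieSubmodule.mem_inf _ _ _).2 ⟨hkN' v hvN', hmem k v⟩,
        (hmkk v hvN').trans hv⟩
  · by_cases hj : j = k
    · rw [hj]; exact hkN' v hv
    · exact hcov.le (hother j hj v hv)

/-- A chain of submodules from `N` to `M` that grows by one simple module in one summand at a time,
together with the filtrations it induces on the summands. -/
structure IsSummandChain (b : (LieAlgebra.IsKilling.rootSystem H).Base)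
    (A : ι → LieSubmodule ℂ p M) (N : LieSubmodule ℂ g M) (l : ℕ) (C : ℕ → LieSubmodule ℂ g M)
    (n : ι → ℕ) (F : ι → ℕ → LieSubmodule ℂ p M) : Prop where
  zero : C 0 = N
  last : C l = ⊤
  iSup_inf : ∀ i ≤ l, ⨆ j, resSubmodule p (C i) ⊓ A j = resSubmodule p (C i)
  filtration_zero : ∀ j, F j 0 = resSubmodule p N ⊓ A j
  filtration_last : ∀ j, F j (n j) = A j
  filtration_lt : ∀ j, ∀ t < n j, F j t < F j (t + 1)
  filtration_subquotient : ∀ j, ∀ t < n j, ∃ μ : Dual ℂ H,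
    Nonempty (Subquotient (F j t) (F j (t + 1)) ≃ₗ⁅ℂ, p⁆ SimpleHW b μ)
  step : ∀ i < l, ∃ k, IsSummandStep b A (C i) (C (i + 1)) k ∧ ∃ a : ι → ℕ, (∀ j, a j ≤ n j) ∧
    a k < n k ∧ (∀ j, F j (a j) = resSubmodule p (C i) ⊓ A j) ∧
    F k (a k + 1) = resSubmodule p (C (i + 1)) ⊓ A k

theorem nonempty_subquotient_of_eq {μ : Dual ℂ H} {A A' B B' : LieSubmodule ℂ p M} (h : B = A)
    (h' : B' = A') (hA : Nonempty (Subquotient A A' ≃ₗ⁅ℂ, p⁆ SimpleHW b μ)) :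
    Nonempty (Subquotient B B' ≃ₗ⁅ℂ, p⁆ SimpleHW b μ) := by
  rwa [h, h']

/-- Prepending `N` shifts only the filtration of `A k`; the others already start at `N ∩ A j`, since
`N` and `N'` meet those summands equally. Indexing by `ℕ` makes the shift a case split. -/
theorem IsSummandChain.cons [DecidableEq ι] {A : ι → LieSubmodule ℂ p M}
    {N N' : LieSubmodule ℂ g M} {k : ι} (hstep : IsSummandStep b A N N' k)
    (hsup : ⨆ j, resSubmodule p N ⊓ A j = resSubmodule p N) {l : ℕ}
    {C : ℕ → LieSubmodule ℂ g M} {n : ι → ℕ} {F : ι → ℕ → LieSubmodule ℂ p M}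
    (h : IsSummandChain b A N' l C n F) :
    IsSummandChain b A N (l + 1) (fun i ↦ Nat.casesOn i N C) (fun j ↦ if j = k then n j + 1 else n j)
      (fun j t ↦ if j = k then Nat.casesOn t (resSubmodule p N ⊓ A j) (F j) else F j t) where
  zero := rfl
  last := h.last
  iSup_inf i hi := by
    cases i with
    | zero => exact hsup
    | succ i => exact h.iSup_inf i (by omega)
  filtration_zero j := by
    by_cases hj : j = k
    · simp [hj]
    · simp [hj, h.filtration_zero, hstep.inf_eq]
  filtration_last j := by
    by_cases hj : j = k
    · subst hj; simpa using h.filtration_last j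
    · simpa [hj] using h.filtration_last j
  filtration_lt j t ht := by
    by_cases hj : j = k
    · subst hj
      cases t with
      | zero => simpa [h.filtration_zero] using hstep.inf_lt
      | succ t => simpa using h.filtration_lt j t (by simpa using ht)
    · simp only [hj, if_false] at ht ⊢
      exact h.filtration_lt j t ht
  filtration_subquotient j t ht := by
    by_cases hj : j = k
    · subst hj
      simp only [if_true] at ht
      cases t with
      | zero =>
        obtain ⟨μ, -, hμ⟩ := hstep.subquotient
        rw [← h.filtration_zero] at hμ
        exact ⟨μ, nonempty_subquotient_of_eq (if_pos rfl) (if_pos rfl) hμ⟩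
      | succ t =>
        obtain ⟨μ, hμ⟩ := h.filtration_subquotient j t (by omega)
        exact ⟨μ, nonempty_subquotient_of_eq (if_pos rfl) (if_pos rfl) hμ⟩
    · simp only [hj, if_false] at ht
      obtain ⟨μ, hμ⟩ := h.filtration_subquotient j t ht
      exact ⟨μ, nonempty_subquotient_of_eq (if_neg hj) (if_neg hj) hμ⟩
  step i hi := by
    cases i with
    | zero =>
      refine ⟨k, ?_, fun _ ↦ 0, fun j ↦ Nat.zero_le _, by simp, fun j ↦ ?_, ?_⟩
      · change IsSummandStep b A N (C 0) k
        rwa [h.zero]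
      · by_cases hj : j = k
        · simp [hj]
        · simp [hj, h.filtration_zero, hstep.inf_eq]
      · simp [h.filtration_zero, h.zero]
    | succ i =>
      obtain ⟨k', hs, a, han, hak, ha, hak'⟩ := h.step i (by omega)
      refine ⟨k', hs, fun j ↦ if j = k then a j + 1 else a j, fun j ↦ ?_, ?_, fun j ↦ ?_, ?_⟩
      · have := han j
        dsimp only
        split_ifs <;> omega
      · dsimp only
        split_ifs <;> omega
      · by_cases hj : j = k
        · simpa [hj] using ha k
        · simpa [hj] using ha j
      · by_cases hj : k' = k
        · subst hj; simpa using hak'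
        · simpa [hj] using hak'

theorem CategoryO.exists_isSummandChain (hM : CategoryO b M) (hp : borel b ≤ p) [Fintype ι]
    {A : ι → LieSubmodule ℂ p M} (hA : IsInternalSum ⊤ A) :
    ∃ (l : ℕ) (C : ℕ → LieSubmodule ℂ g M) (n : ι → ℕ) (F : ι → ℕ → LieSubmodule ℂ p M),
      IsSummandChain b A ⊥ l C n F := by
  classical
  obtain ⟨π, hmem, hfix, horth, hsum, hlie⟩ := exists_projections hA
  have := hM.wellFoundedGT
  -- Stability under the projections is the invariant carried by the upward Noetherian induction.
  suffices h : ∀ N : LieSubmodule ℂ g M, (∀ j, ∀ v ∈ N, π j v ∈ N) →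
      ∃ (l : ℕ) (C : ℕ → LieSubmodule ℂ g M) (n : ι → ℕ) (F : ι → ℕ → LieSubmodule ℂ p M),
        IsSummandChain b A N l C n F from h ⊥ fun j v hv ↦ by
    rw [LieSubmodule.mem_bot] at hv ⊢
    rw [hv, map_zero]
  intro N
  induction N using WellFoundedGT.induction with
  | ind N ih =>
    intro hN
    by_cases htop : N = ⊤
    · subst htop
      have hres : ∀ j, resSubmodule p (⊤ : LieSubmodule ℂ g M) ⊓ A j = A j := fun j ↦
        inf_eq_right.2 fun v _ ↦ LieSubmodule.mem_top v
      exact ⟨0, fun _ ↦ ⊤, fun _ ↦ 0, fun j _ ↦ A j, rfl, rfl,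
        fun _ _ ↦ iSup_resSubmodule_inf hmem hsum hN, fun j ↦ (hres j).symm, fun _ ↦ rfl,
        fun _ _ h ↦ absurd h (Nat.not_lt_zero _), fun _ _ h ↦ absurd h (Nat.not_lt_zero _),
        fun _ h ↦ absurd h (Nat.not_lt_zero _)⟩
    · obtain ⟨k, N', hstep, hN'⟩ := hM.exists_isSummandStep hp hmem hfix horth hsum hlie hN htop
      obtain ⟨l, C, n, F, h⟩ := ih N' hstep.covBy.lt hN'
      exact ⟨_, _, _, _, h.cons hstep (iSup_resSubmodule_inf hmem hsum hN)⟩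

theorem IsSummandChain.isSimpleResFiltration {A : ι → LieSubmodule ℂ p M} {l : ℕ}
    {C : ℕ → LieSubmodule ℂ g M} {n : ι → ℕ} {F : ι → ℕ → LieSubmodule ℂ p M}
    (h : IsSummandChain b A ⊥ l C n F) (j : ι) :
    IsSimpleResFiltration b p (A j) (fun t : Fin (n j + 1) ↦ F j t) where
  zero := by
    refine (h.filtration_zero j).trans (eq_bot_iff.2 fun v hv ↦ ?_)
    exact ((LieSubmodule.mem_inf _ _ _).1 hv).1
  last := h.filtration_last j
  lt_succ t := h.filtration_lt j t t.2
  subquotient t := h.filtration_subquotient j t t.2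

theorem isInternalSum_pair {k : Type*} [LieRing k] [LieAlgebra ℂ k] [LieRingModule k M]
    [LieModule ℂ k M] {A B : LieSubmodule ℂ k M} (h : IsCompl A B) :
    IsInternalSum ⊤ ![A, B] := by
  constructor
  · rw [iSupIndep_pair (i := 0) (j := 1) (by decide) (by decide)]
    exact h.disjoint
  · rw [← h.sup_eq_top]
    refine le_antisymm (iSup_le fun i ↦ ?_)
      (sup_le (le_iSup (![A, B]) (0 : Fin 2)) (le_iSup (![A, B]) (1 : Fin 2)))
    fin_cases i
    · exact le_sup_left
    · exact le_sup_right

end Chain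

end CatO

end

/-! ### The theorem -/

theorem mainTheorem7
    {g : Type*} [LieRing g] [LieAlgebra ℂ g] [FiniteDimensional ℂ g] [LieAlgebra.IsSemisimple ℂ g]
    (H : LieSubalgebra ℂ g) [H.IsCartanSubalgebra]
    (b : (LieAlgebra.IsKilling.rootSystem H).Base)
    (p : LieSubalgebra ℂ g) (hp : CatO.borel b ≤ p)
    {M : Type*} [AddCommGroup M] [Module ℂ M] [LieRingModule g M] [LieModule ℂ g M]
    (hM : CatO.CategoryO b M) :
    (∀ A : LieSubmodule ℂ p M, (∃ B : LieSubmodule ℂ p M, IsCompl A B) →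
      ∃ (n : ℕ) (F : Fin (n + 1) → LieSubmodule ℂ p M), CatO.IsSimpleResFiltration b p A F) ∧
    (∀ (m : ℕ) (A : Fin m → LieSubmodule ℂ p M), CatO.IsInternalSum ⊤ A →
      ∃ (l : ℕ) (N : Fin (l + 1) → LieSubmodule ℂ g M)
        (n : Fin m → ℕ) (F : ∀ j, Fin (n j + 1) → LieSubmodule ℂ p M),
        CatO.IsCompSeries N ∧
        (∀ j, CatO.IsSimpleResFiltration b p (A j) (F j)) ∧
        ∀ i : Fin l, ∃ (a : ∀ j, Fin (n j + 1)) (k : Fin m) (r : Fin (n k)) (μ : Dual ℂ H),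
          a k = r.castSucc ∧
          CatO.IsInternalSum (CatO.resSubmodule p (N i.castSucc)) (fun j ↦ F j (a j)) ∧
          CatO.IsInternalSum (CatO.resSubmodule p (N i.succ))
            (fun j ↦ F j (Function.update a k r.succ j)) ∧
          Nonempty (CatO.Subquotient (N i.castSucc) (N i.succ) ≃ₗ⁅ℂ, g⁆ CatO.SimpleHW b μ) ∧
          Nonempty (CatO.Subquotient (F k r.castSucc) (F k r.succ) ≃ₗ⁅ℂ, p⁆
            CatO.SimpleHW b μ)) := by

  constructor
  · rintro A ⟨B, hAB⟩
    -- A direct summand with its complement is a two-term decomposition, and index 0 is `A`.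
    obtain ⟨l, C, n, F, h⟩ := hM.exists_isSummandChain hp (CatO.isInternalSum_pair hAB)
    exact ⟨_, _, h.isSimpleResFiltration 0⟩
  · intro m A hA
    obtain ⟨l, C, n, F, h⟩ := hM.exists_isSummandChain hp hA
    refine ⟨l, fun i ↦ C i, n, fun j t ↦ F j t, ⟨h.zero, h.last, fun i ↦ ?_⟩,
      h.isSimpleResFiltration, fun i ↦ ?_⟩
    · obtain ⟨k, hs, -⟩ := h.step i i.2
      exact hs.covBy
    · obtain ⟨k, hs, a, han, hak, ha, hak'⟩ := h.step i i.2
      obtain ⟨μ, hμ, hμ'⟩ := hs.subquotient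
      -- After raising the `k`-th index, every term is the intersection of the next series member
      -- with `A j`, so both direct sums follow from independence of the `A j` and `iSup_inf`.
      have hupd : ∀ j, F j (Function.update (fun j ↦ (⟨a j, Nat.lt_succ_of_le (han j)⟩ :
          Fin (n j + 1))) k (Fin.succ ⟨a k, hak⟩) j) =
          CatO.resSubmodule p (C (i + 1)) ⊓ A j := by
        intro j
        by_cases hj : j = k
        · subst hj
          rw [Function.update_self]
          exact hak'
        · rw [Function.update_of_ne hj, hs.inf_eq j hj]
          exact ha j
      refine ⟨fun j ↦ ⟨a j, Nat.lt_succ_of_le (han j)⟩, k, ⟨a k, hak⟩, μ, rfl, ⟨?_, ?_⟩, ⟨?_, ?_⟩,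
        hμ, ?_⟩
      · exact hA.1.mono fun j ↦ (ha j).le.trans inf_le_right
      · exact (iSup_congr ha).trans (h.iSup_inf i i.2.le)
      · exact hA.1.mono fun j ↦ (hupd j).le.trans inf_le_right
      · exact (iSup_congr hupd).trans (h.iSup_inf (i + 1) i.2)
      · change Nonempty (CatO.Subquotient (F k (a k)) (F k (a k + 1)) ≃ₗ⁅ℂ, p⁆ CatO.SimpleHW b μ)
        rw [ha, hak']
        exact hμ'
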